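/- Let $n\ge 3$ and let $e_n$ be the last vector of the standard basis of $\mathbb{R}^n$. Let $\mathcal M\subset\mathbb{R}^n$ be a smooth, orientable, embedded hypersurface (without boundary) with zero mean curvature, and let $\gamma:\mathcal M\to S^{n-1}$ be its Gauss map (a continuous unit normal field). Suppose that $\mathcal M$ is a tube in the $e_n$-direction: there is a nonempty open interval $t(\mathcal M)\subset\mathbb{R}$ such that for every $t\in t(\mathcal M)$ the cross-section $\Sigma_t=\mathcal M\cap\Pi_t$, $\Pi_t=\{x\in\mathbb{R}^n: x_n=t\}$, is nonempty and compact, and for all $t_1,t_2\in t(\mathcal M)$ the set $\mathcal M\cap\{t_1\le x_n\le t_2\}$ is compact. Let $t\in t(\mathcal M)$ be a regular value of $x_n|_{\mathcal M}$, and let $\Sigma\subset\Sigma_t$ be a simple cycle: a connected, nonempty union of finitely many connected components of $\Sigma_t$ which is the boundary of an open subset $\Omega$ of the hyperplane $\Pi_t$ lying on one side of $\Sigma$ (that is, $\Sigma=\partial\Omega=\partial\overline{\Omega}$, boundaries and closure taken in $\Pi_t$). Let $\nu$ be the unit normal to $\Sigma_t$ in $\mathcal M$ that is exterior to $\mathcal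 M\cap\{x_n<t\}$ (so $\nu$ is the normalized projection of $e_n$ to the tangent space of $\mathcal M$), let $J(\Sigma)=\int_\Sigma \nu\in\mathbb{R}^n$ be the flow vector, the integral being taken with respect to the $(n-2)$-dimensional surface measure, and let $\alpha(\Sigma)\in[0,\pi]$ be the angle between $J(\Sigma)$ and $e_n$. Then $$d(\gamma(\Sigma))\ \ge\ 2\,\alpha(\Sigma),$$ where $d(E)=\sup_{u,v\in E}\arccos\langle u,v\rangle$ is the spherical diameter of a set $E\subset S^{n-1}$. -/

import Mathlib

open MeasureTheory Set
open scoped Gradient ContDiff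

namespace MinimalTube

noncomputable section

/-- The Euclidean space `ℝⁿ` with `n = d + 1`, so that `d = n - 1` is the dimension of a
hypersurface. -/
abbrev Space (d : ℕ) := EuclideanSpace ℝ (Fin (d + 1))

/-- The axis `e_n`, the last vector of the standard basis. -/
def axis (d : ℕ) : Space d := EuclideanSpace.single (Fin.last d) 1

/-- The horizontal hyperplane `Π_t = {x_n = t}`. -/
def hyperplane (d : ℕ) (t : ℝ) : Set (Space d) := {x | x (Fin.last d) = t}

/-- The cross-section `Σ_t = M ∩ Π_t`. -/
def crossSection {d : ℕ} (M : Set (Space d)) (t : ℝ) : Set (Space d) := M ∩ hyperplane d t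

/-- `f` is a smooth function on the open set `U`, without critical points there, and `M` is its
zero set in `U`. -/
structure IsDefiningFunction {d : ℕ} (M U : Set (Space d)) (f : Space d → ℝ) : Prop where
  isOpen : IsOpen U
  smooth : ContDiffOn ℝ ∞ f U
  regular : ∀ x ∈ U, ∇ f x ≠ 0
  zeroSet : M ∩ U = {x ∈ U | f x = 0}

/-- `M` is a smooth embedded hypersurface (without boundary): locally it is the zero set of a
smooth function without critical points. -/
def IsEmbeddedHypersurface {d : ℕ} (M : Set (Space d)) : Prop :=
  ∀ p ∈ M, ∃ U f, p ∈ U ∧ IsDefiningFunction M U f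

/-- The tangent space `T_p M`: the kernel of the differential at `p` of the local defining functions
of `M` near `p` (any two of them have the same kernel). -/
def tangentSpace {d : ℕ} (M : Set (Space d)) (p : Space d) : Submodule ℝ (Space d) where
  carrier := {v | ∀ U f, p ∈ U → IsDefiningFunction M U f → fderiv ℝ f p v = 0}
  zero_mem' := by
    intro U f _ _
    exact map_zero _
  add_mem' := by
    intro v w hv hw U f hp hf
    rw [map_add, hv U f hp hf, hw U f hp hf, add_zero]
  smul_mem' := by
    intro c v hv U f hp hf
    rw [map_smul, hv U f hp hf, smul_zero]

/-- The divergence of a vector field: the trace of its differential. -/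
def divergence {d : ℕ} (X : Space d → Space d) (p : Space d) : ℝ :=
  LinearMap.trace ℝ (Space d) (fderiv ℝ X p : Space d →ₗ[ℝ] Space d)

/-- The mean curvature at `p` (sum of the principal curvatures, up to sign) of the level
hypersurface of `f` through `p`: the divergence of the unit normal field `∇f / |∇f|`. -/
def levelSetMeanCurvature {d : ℕ} (f : Space d → ℝ) (p : Space d) : ℝ :=
  divergence (fun x => ‖∇ f x‖⁻¹ • ∇ f x) p

/-- `M` has zero mean curvature. Up to sign the mean curvature at a point does not depend on the
local defining function. -/
def IsMinimal {d : ℕ} (M : Set (Space d)) : Prop :=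
  ∀ p ∈ M, ∃ U f, p ∈ U ∧ IsDefiningFunction M U f ∧ levelSetMeanCurvature f p = 0

/-- `γ` is a Gauss map of `M`: a continuous unit normal field along `M`. An embedded hypersurface
is orientable exactly when it has one. -/
structure IsGaussMap {d : ℕ} (M : Set (Space d)) (γ : Space d → Space d) : Prop where
  continuousOn : ContinuousOn γ M
  norm_eq_one : ∀ p ∈ M, ‖γ p‖ = 1
  normal : ∀ p ∈ M, γ p ∈ (tangentSpace M p)ᗮ

/-- `M` is a tube in the `e_n`-direction with projection interval `I`. -/
structure IsTube {d : ℕ} (M : Set (Space d)) (I : Set ℝ) : Prop where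
  isOpen : IsOpen I
  ordConnected : I.OrdConnected
  nonempty : I.Nonempty
  section_nonempty : ∀ t ∈ I, (crossSection M t).Nonempty
  section_compact : ∀ t ∈ I, IsCompact (crossSection M t)
  slab_compact : ∀ t₁ ∈ I, ∀ t₂ ∈ I,
    IsCompact (M ∩ {x | t₁ ≤ x (Fin.last d) ∧ x (Fin.last d) ≤ t₂})

/-- `t` is a regular value of the coordinate function `x_n` restricted to `M`. -/
def IsRegularValue {d : ℕ} (M : Set (Space d)) (t : ℝ) : Prop :=
  ∀ p ∈ crossSection M t, ∃ v ∈ tangentSpace M p, v (Fin.last d) ≠ 0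

/-- A cycle in `Σ_t`, `t` a regular value: a union of finitely many (at least one) connected
components of `Σ_t`. -/
structure IsCycle {d : ℕ} (M : Set (Space d)) (t : ℝ) (S : Set (Space d)) : Prop where
  regular : IsRegularValue M t
  components : ∃ P : Set (Space d), P.Finite ∧ P.Nonempty ∧ P ⊆ crossSection M t ∧
    S = ⋃ p ∈ P, connectedComponentIn (crossSection M t) p

/-- `S ⊆ Π_t` is the boundary of an open subset `Ω` of the hyperplane `Π_t` (topology of `Π_t`),
with `Ω` on one side only: each point of `S` is also a limit of points outside the closure of `Ω`.
-/
def BoundsInHyperplane {d : ℕ} (t : ℝ) (S : Set (Space d)) : Prop :=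
  S ⊆ hyperplane d t ∧ ∃ Ω : Set (hyperplane d t), IsOpen Ω ∧
    frontier Ω = Subtype.val ⁻¹' S ∧ frontier (closure Ω) = Subtype.val ⁻¹' S

/-- A simple cycle: a connected cycle that bounds an open subset of `Π_t`. -/
structure IsSimpleCycle {d : ℕ} (M : Set (Space d)) (t : ℝ) (S : Set (Space d)) : Prop where
  cycle : IsCycle M t S
  connected : IsConnected S
  bounds : BoundsInHyperplane t S

/-- The exterior unit normal `ν` in `M` to `Σ_t` as a boundary of `M ∩ {x_n < t}`: the normalized
gradient on `M` of the function `x_n`, that is, the normalized projection of `e_n` to `T_p M`. -/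
def conormal {d : ℕ} (M : Set (Space d)) (p : Space d) : Space d :=
  ‖(tangentSpace M p).starProjection (axis d)‖⁻¹ • (tangentSpace M p).starProjection (axis d)

/-- The flow vector `J(Σ) = ∫_Σ ν` with respect to the `(n-2)`-dimensional surface measure. -/
def flowVector {d : ℕ} (M S : Set (Space d)) : Space d :=
  ∫ p in S, conormal M p ∂(Measure.euclideanHausdorffMeasure (d - 1))

/-- The spherical diameter of a subset of the unit sphere: the supremum of the angles (spherical
distances) between its points. -/
def sphericalDiam {d : ℕ} (A : Set (Space d)) : ℝ :=
  sSup {θ | ∃ u ∈ A, ∃ v ∈ A, θ = InnerProductGeometry.angle u v}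

end

end MinimalTube

/-! Write `e` for the axis, `θ` for the angle between `γ` and `e`, and `N` for the normalized
horizontal part of `γ`, a unit normal of the section inside its hyperplane. Regularity of `t` gives
`sin θ > 0`, and `γ = cos θ • e + sin θ • N`. The conormal is then `sin θ • e - cos θ • N`, so `⟪e,
J⟫ = ∫ sin θ > 0`, while for horizontal `w` one has `⟪w, J⟫ = -∫ cos θ ⟪N, w⟫`.

Since the cycle bounds a region of the hyperplane lying on one side, `∫ N = 0`. Any constant
multiple of `⟪N, w⟫` may thus be added under the integral. Let `[m - r, m + r]` be the range of `θ`
on the cycle. The elementary bound `|cos m - cos r cos θ| ≤ sin r sin θ`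
(`abs_cos_sub_cos_mul_cos_le`) yields `cos r ⟪w, J⟫ ≤ sin r ⟪e, J⟫` for every horizontal `w` of norm
at most one, so `J` makes an angle at most `r` with `e`. Finally `2 * r` is the difference of two
values of `θ`, which the triangle inequality on the sphere bounds by the angle between two values of
`γ`.

The bulk of the work is `∫ N = 0` with respect to Hausdorff measure
(`integral_inner_normal_eq_zero`), a divergence theorem for constant fields. Near a boundary point,
Fubini along lines of a transversal direction, together with an area estimate for the projection
along that direction, compares the integral over `Ω` of a derivative of a bump function with a
boundary integral, up to small relative error. A partition of unity sums these estimates, and the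
sum of the interior integrals vanishes exactly. -/

namespace MinimalTube

open Filter Topology Module Metric
open scoped ENNReal NNReal RealInnerProductSpace

/-! ### Projection along a unit vector, and a linear correction of its distortion -/

section Projection

variable {E : Type*} [NormedAddCommGroup E] [InnerProductSpace ℝ E]

/-- The orthogonal projection along `e` onto the hyperplane orthogonal to `e`. -/
noncomputable def perpProj (e : E) : E →L[ℝ] (ℝ ∙ e)ᗮ := ((ℝ ∙ e)ᗮ).orthogonalProjectionOnto

theorem coe_perpProj {e : E} (he : ‖e‖ = 1) (x : E) : (perpProj e x : E) = x - ⟪e, x⟫ • e := by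
  have := Submodule.starProjection_orthogonal_val (K := ℝ ∙ e) x
  rw [Submodule.starProjection_unit_singleton ℝ he] at this
  exact this

theorem norm_sq_perpProj {e : E} (he : ‖e‖ = 1) (x : E) :
    ‖perpProj e x‖ ^ 2 = ‖x‖ ^ 2 - ⟪e, x⟫ ^ 2 := by
  rw [Submodule.coe_norm, coe_perpProj he, norm_sub_sq_real, norm_smul, inner_smul_right,
    real_inner_comm, he, Real.norm_eq_abs, mul_one, sq_abs]
  ring

theorem inner_perpProj {e : E} (he : ‖e‖ = 1) (x y : E) :
    ⟪perpProj e x, perpProj e y⟫ = ⟪x, y⟫ - ⟪e, x⟫ * ⟪e, y⟫ := by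
  rw [Submodule.coe_inner, coe_perpProj he, coe_perpProj he, inner_sub_left, inner_sub_right,
    inner_sub_right, inner_smul_left, inner_smul_right, inner_smul_left, inner_smul_right,
    real_inner_self_eq_norm_sq, he, real_inner_comm e x]
  simp
  ring

/-- On the hyperplane `eᗮ` there is a linear map with determinant `|⟪N, e⟫|⁻¹` which turns the
projection along `e`, restricted to the hyperplane `Nᗮ`, into an isometry. -/
theorem exists_linearMap_perpProj [FiniteDimensional ℝ E] {N e : E} (hN : ‖N‖ = 1) (he : ‖e‖ = 1) (hc : ⟪N, e⟫ ≠ 0) :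
    ∃ L : (ℝ ∙ e)ᗮ →ₗ[ℝ] (ℝ ∙ e)ᗮ, LinearMap.det L = |⟪N, e⟫|⁻¹ ∧
      ∀ w : E, |‖L (perpProj e w)‖ ^ 2 - ‖w‖ ^ 2| ≤ 3 / ⟪N, e⟫ ^ 2 * |⟪N, w⟫| * ‖w‖ := by
  set c := ⟪N, e⟫ with hcdef
  set a := perpProj e N with ha
  have hc0 : 0 < |c| := abs_pos.2 hc
  have hc1 : |c| ≤ 1 := by
    have := abs_real_inner_le_norm N e
    rwa [hN, he, one_mul] at this
  have hcc : |c| ^ 2 = c ^ 2 := sq_abs c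
  have haa : ⟪a, a⟫ = 1 - |c| ^ 2 := by
    rw [ha, inner_perpProj he, real_inner_self_eq_norm_sq, hN, real_inner_comm, hcc, hcdef]
    ring
  -- The projection shrinks `Nᗮ` by the factor `|c|` in the direction of `a` only. As `‖a‖ ^ 2 = 1 -
  -- c ^ 2`, this coefficient makes the map stretch `a` by `1 / |c|` and fix `aᗮ`.
  refine ⟨LinearMap.transvection ((1 / (|c| * (1 + |c|))) • (innerₛₗ ℝ a)) a, ?_, fun w => ?_⟩
  · rw [LinearMap.transvection.det]
    simp only [LinearMap.smul_apply, innerₛₗ_apply_apply, smul_eq_mul, haa]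
    field_simp
    ring
  · rw [LinearMap.transvection.apply]
    simp only [LinearMap.smul_apply, innerₛₗ_apply_apply, smul_eq_mul]
    have h1 : ⟪a, perpProj e w⟫ = ⟪N, w⟫ - c * ⟪e, w⟫ := by
      rw [ha, inner_perpProj he, hcdef, real_inner_comm N e]
    have h2 := norm_sq_perpProj he w
    rw [norm_add_sq_real, inner_smul_right, norm_smul, mul_pow, ← real_inner_self_eq_norm_sq a,
      haa, real_inner_comm a, h1, h2, Real.norm_eq_abs, sq_abs]
    set s := ⟪N, w⟫
    set u := ⟪e, w⟫
    have hu : |u| ≤ ‖w‖ := by simpa [he] using abs_real_inner_le_norm e w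
    have hs : |s| ≤ ‖w‖ := by simpa [hN] using abs_real_inner_le_norm N w
    -- The defect of isometry carries a factor `s = ⟪N, w⟫`, so it vanishes on `Nᗮ` and is small for
    -- `w` nearly orthogonal to `N`.
    have key : ‖w‖ ^ 2 - u ^ 2 + 2 * (1 / (|c| * (1 + |c|)) * (s - c * u) * (s - c * u)) +
        (1 / (|c| * (1 + |c|)) * (s - c * u)) ^ 2 * (1 - |c| ^ 2) - ‖w‖ ^ 2
        = (s ^ 2 - 2 * c * s * u) / |c| ^ 2 := by
      have h3 : (s - c * u) ^ 2 - |c| ^ 2 * u ^ 2 = s ^ 2 - 2 * c * s * u := by rw [hcc]; ring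
      rw [← h3]
      field_simp
      ring
    rw [key, abs_div, abs_of_pos (pow_pos hc0 2), ← hcc]
    have h4 : |s ^ 2 - 2 * c * s * u| ≤ 3 * |s| * ‖w‖ := by
      have h5 : s ^ 2 - 2 * c * s * u = s * (s - 2 * c * u) := by ring
      rw [h5, abs_mul]
      have h6 : |s - 2 * c * u| ≤ 3 * ‖w‖ := by
        calc |s - 2 * c * u| ≤ |s| + |2 * c * u| := abs_sub _ _
          _ = |s| + 2 * (|c| * |u|) := by rw [abs_mul, abs_mul, abs_two]; ring
          _ ≤ ‖w‖ + 2 * (1 * ‖w‖) := by gcongr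
          _ = 3 * ‖w‖ := by ring
      calc |s| * |s - 2 * c * u| ≤ |s| * (3 * ‖w‖) := by gcongr
        _ = _ := by ring
    calc _ ≤ 3 * |s| * ‖w‖ / |c| ^ 2 := by gcongr
      _ = _ := by ring

end Projection

/-! ### Hausdorff measure of nearly flat sets under projection -/

section Area

variable {E : Type*} [NormedAddCommGroup E] [InnerProductSpace ℝ E] [FiniteDimensional ℝ E]
  [MeasurableSpace E] [BorelSpace E]

theorem euclideanHausdorffMeasure_image_le {X Y : Type*} [EMetricSpace X] [MeasurableSpace X]
    [BorelSpace X] [EMetricSpace Y] [MeasurableSpace Y] [BorelSpace Y] {f : X → Y} {A : Set X}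
    {K : ℝ≥0} (hf : LipschitzOnWith K f A) (k : ℕ) :
    μHE[k] (f '' A) ≤ (K : ℝ≥0∞) ^ k * μHE[k] A := by
  have h := hf.hausdorffMeasure_image_le (d := k) (by positivity)
  rw [ENNReal.rpow_natCast] at h
  simp_rw [Measure.euclideanHausdorffMeasure_def, Measure.smul_apply, ENNReal.smul_def,
    smul_eq_mul]
  rw [mul_left_comm]
  gcongr

theorem euclideanHausdorffMeasure_le_image {X Y : Type*} [EMetricSpace X] [MeasurableSpace X]
    [BorelSpace X] [EMetricSpace Y] [MeasurableSpace Y] [BorelSpace Y] {f : X → Y} {A : Set X}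
    {K : ℝ≥0} (hf : ∀ x ∈ A, ∀ y ∈ A, edist x y ≤ K * edist (f x) (f y)) (k : ℕ) :
    μHE[k] A ≤ (K : ℝ≥0∞) ^ k * μHE[k] (f '' A) := by
  have h1 : AntilipschitzWith K (fun x : A => f x) := fun x y => hf x x.2 y y.2
  have h2 := h1.le_hausdorffMeasure_image (d := k) (by positivity) univ
  have h3 : μH[(k : ℝ)] (univ : Set A) = μH[(k : ℝ)] A := by
    rw [← (isometry_subtype_coe (s := A)).hausdorffMeasure_image (Or.inl (by positivity))]
    simp
  rw [ENNReal.rpow_natCast, h3, image_univ, ← image_eq_range] at h2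
  simp_rw [Measure.euclideanHausdorffMeasure_def, Measure.smul_apply, ENNReal.smul_def,
    smul_eq_mul]
  rw [mul_left_comm]
  gcongr

/-- The projection along `e` of a set that is nearly orthogonal to `N` nearly contracts the
`k`-dimensional measure by the factor `|⟪N, e⟫|`. -/
theorem exists_forall_volume_perpProj_image {k : ℕ} (hk : finrank ℝ E = k + 1) {N e : E}
    (hN : ‖N‖ = 1) (he : ‖e‖ = 1) (hc : ⟪N, e⟫ ≠ 0) {K : ℝ} (hK : 1 < K) :
    ∃ η > 0, ∀ A : Set E, (∀ x ∈ A, ∀ y ∈ A, |⟪N, x - y⟫| ≤ η * ‖x - y‖) →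
      InjOn (perpProj e) A ∧
      volume (perpProj e '' A) ≤ ENNReal.ofReal (|⟪N, e⟫| * K) * μHE[k] A ∧
      ENNReal.ofReal |⟪N, e⟫| * μHE[k] A ≤ ENNReal.ofReal K * volume (perpProj e '' A) := by
  obtain ⟨L, hdet, hL⟩ := exists_linearMap_perpProj hN he hc
  set c := ⟪N, e⟫
  have hc0 : 0 < |c| := abs_pos.2 hc
  -- A map that is `κ`-Lipschitz in both directions changes `k`-dimensional measure by at most `κ ^
  -- k`.
  obtain ⟨κ, hκ1, hκK⟩ : ∃ κ : ℝ, 1 < κ ∧ κ ^ k < K := by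
    have h1 : Tendsto (fun κ : ℝ => κ ^ k) (𝓝[>] 1) (𝓝 (1 ^ k)) :=
      ((continuous_pow k).tendsto 1).mono_left nhdsWithin_le_nhds
    rw [one_pow] at h1
    obtain ⟨κ, h2, h3⟩ := ((h1.eventually (gt_mem_nhds hK)).and self_mem_nhdsWithin).exists
    exact ⟨κ, h3, h2⟩
  have hκ0 : 0 < κ := by linarith
  -- With this `ε` both `1 + ε ≤ κ ^ 2` and `(1 - ε)⁻¹ = κ ^ 2`, so a relative error `ε` in squared
  -- distances gives the Lipschitz constant `κ` both ways.
  set ε := 1 - (κ ^ 2)⁻¹ with hε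
  have hε0 : 0 < ε := by
    have : (κ ^ 2)⁻¹ < 1 := inv_lt_one_of_one_lt₀ (by nlinarith)
    linarith
  have hε1 : 1 + ε ≤ κ ^ 2 := by
    have h1 : κ ^ 2 * (κ ^ 2)⁻¹ = 1 := mul_inv_cancel₀ (by positivity)
    have h2 : 0 < (κ ^ 2)⁻¹ := by positivity
    nlinarith [sq_nonneg (κ ^ 2 - 1)]
  have hε2 : κ ^ 2 * (1 - ε) = 1 := by rw [hε]; field_simp; ring
  refine ⟨ε * c ^ 2 / 3, by positivity, fun A hA => ?_⟩
  set f : E → (ℝ ∙ e)ᗮ := fun x => L (perpProj e x) with hf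
  have hsub : ∀ x y, f x - f y = L (perpProj e (x - y)) := fun x y => by simp [hf]
  have hmain : ∀ x ∈ A, ∀ y ∈ A, |‖f x - f y‖ ^ 2 - ‖x - y‖ ^ 2| ≤ ε * ‖x - y‖ ^ 2 := by
    intro x hx y hy
    rw [hsub]
    refine (hL (x - y)).trans ?_
    calc 3 / c ^ 2 * |⟪N, x - y⟫| * ‖x - y‖
        ≤ 3 / c ^ 2 * (ε * c ^ 2 / 3 * ‖x - y‖) * ‖x - y‖ := by
          gcongr; exact hA x hx y hy
      _ = ε * ‖x - y‖ ^ 2 := by field_simp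
  have hup : ∀ x ∈ A, ∀ y ∈ A, ‖f x - f y‖ ≤ κ * ‖x - y‖ := by
    intro x hx y hy
    refine le_of_sq_le_sq ?_ (by positivity)
    have := (abs_le.1 (hmain x hx y hy)).2
    nlinarith [sq_nonneg ‖x - y‖]
  have hlow : ∀ x ∈ A, ∀ y ∈ A, ‖x - y‖ ≤ κ * ‖f x - f y‖ := by
    intro x hx y hy
    refine le_of_sq_le_sq ?_ (by positivity)
    have := (abs_le.1 (hmain x hx y hy)).1
    have h2 : (1 - ε) * ‖x - y‖ ^ 2 ≤ ‖f x - f y‖ ^ 2 := by linarith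
    calc ‖x - y‖ ^ 2 = κ ^ 2 * ((1 - ε) * ‖x - y‖ ^ 2) := by rw [← mul_assoc, hε2, one_mul]
      _ ≤ κ ^ 2 * ‖f x - f y‖ ^ 2 := by gcongr
      _ = _ := by ring
  have hinj : InjOn f A := by
    intro x hx y hy hxy
    have := hlow x hx y hy
    rw [hxy, sub_self, norm_zero, mul_zero] at this
    exact sub_eq_zero.1 (norm_le_zero_iff.1 this)
  have hfr : finrank ℝ (ℝ ∙ e)ᗮ = k := by
    have : Fact (finrank ℝ E = k + 1) := ⟨hk⟩
    exact Submodule.finrank_orthogonal_span_singleton (by rintro rfl; simp at he)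
  have hvol : volume (f '' A) = ENNReal.ofReal |c|⁻¹ * volume (perpProj e '' A) := by
    have : f '' A = L '' (perpProj e '' A) := by rw [image_image]
    rw [this, Measure.addHaar_image_linearMap, hdet, abs_of_pos (by positivity)]
  -- In the `k`-dimensional hyperplane the Hausdorff measure is Lebesgue measure, so the determinant
  -- of `L` supplies the factor `|c|⁻¹`.
  have hμ : (volume : Measure (ℝ ∙ e)ᗮ) = μHE[k] := by
    rw [← InnerProductSpace.euclideanHausdorffMeasure_eq_volume, hfr]
  have hmul : ∀ t : ℝ≥0∞, t = ENNReal.ofReal |c| * (ENNReal.ofReal |c|⁻¹ * t) := by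
    intro t
    rw [← mul_assoc, ← ENNReal.ofReal_mul hc0.le, mul_inv_cancel₀ hc0.ne']
    simp
  have hKκ : (κ.toNNReal : ℝ≥0∞) ^ k ≤ ENNReal.ofReal K := by
    rw [← ENNReal.ofReal, ← ENNReal.ofReal_pow hκ0.le]
    exact ENNReal.ofReal_le_ofReal hκK.le
  refine ⟨fun x hx y hy hxy => hinj hx hy (by simp [hf, hxy]), ?_, ?_⟩
  · have h1 : LipschitzOnWith κ.toNNReal f A := by
      refine LipschitzOnWith.of_dist_le_mul fun x hx y hy => ?_
      rw [dist_eq_norm, dist_eq_norm, Real.coe_toNNReal _ hκ0.le]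
      exact hup x hx y hy
    have h2 := euclideanHausdorffMeasure_image_le h1 k
    rw [← hμ, hvol] at h2
    rw [hmul (volume _), ENNReal.ofReal_mul hc0.le, mul_assoc]
    exact mul_le_mul_right (h2.trans (mul_le_mul_left hKκ _)) _
  · have h1 : ∀ x ∈ A, ∀ y ∈ A, edist x y ≤ κ.toNNReal * edist (f x) (f y) := by
      intro x hx y hy
      rw [edist_dist, edist_dist, ← ENNReal.ofReal, ← ENNReal.ofReal_mul hκ0.le, dist_eq_norm,
        dist_eq_norm]
      exact ENNReal.ofReal_le_ofReal (hlow x hx y hy)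
    have h2 := euclideanHausdorffMeasure_le_image h1 k
    rw [← hμ, hvol] at h2
    rw [hmul (volume _), mul_left_comm (ENNReal.ofReal K)]
    exact mul_le_mul_right (h2.trans (mul_le_mul_left hKκ _)) _

end Area

/-! ### Integration along lines near a boundary point -/

section Local

variable {E : Type*} [NormedAddCommGroup E] [InnerProductSpace ℝ E]

/-- Near `p`, the set `Ω` is the sublevel set `{h < 0}` and its boundary the level set `{h = 0}` of
a function `h` with gradient `n` at `p`. -/
def IsOuterNormal (Ω : Set E) (n p : E) : Prop :=
  ∃ h : E → ℝ, HasStrictFDerivAt h (innerSL ℝ n) p ∧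
    ∀ᶠ x in 𝓝 p, (x ∈ frontier Ω ↔ h x = 0) ∧ (x ∈ Ω ↔ h x < 0)

/-- A quantitative form of `IsOuterNormal` on a ball. -/
theorem IsOuterNormal.exists_ball {Ω : Set E} {n p : E} (h : IsOuterNormal Ω n p) {η : ℝ}
    (hη : 0 < η) : ∃ g : E → ℝ, ∃ r > 0,
      (∀ x ∈ ball p r, (x ∈ frontier Ω ↔ g x = 0) ∧ (x ∈ Ω ↔ g x < 0)) ∧
      ∀ x ∈ ball p r, ∀ y ∈ ball p r, |g x - g y - ⟪n, x - y⟫| ≤ η * ‖x - y‖ := by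
  obtain ⟨g, hg, hev⟩ := h
  have h1 := hg.isLittleO.def hη
  rw [nhds_prod_eq, eventually_prod_self_iff'] at h1
  obtain ⟨t, ht, h2⟩ := h1
  obtain ⟨r, hr, hrt⟩ := Metric.mem_nhds_iff.1 (inter_mem ht hev)
  refine ⟨g, r, hr, fun x hx => (hrt hx).2, fun x hx y hy => ?_⟩
  simpa using h2 x (hrt hx).1 y (hrt hy).1

variable [FiniteDimensional ℝ E]

/-- The integral over `Ω` of the derivative of `φ` in the direction `e`, along the lines of
direction `e`. -/
theorem integral_line_indicator {Ω : Set E} {p e : E} {r : ℝ} (he : ‖e‖ = 1) {g : E → ℝ}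
    (hg : ∀ x ∈ ball p r, (x ∈ frontier Ω ↔ g x = 0) ∧ (x ∈ Ω ↔ g x < 0))
    (hmono : ∀ x ∈ ball p r, ∀ τ > (0 : ℝ), x + τ • e ∈ ball p r → g x < g (x + τ • e))
    {φ : E → ℝ} (hφ : ContDiff ℝ 1 φ) (hsupp : tsupport φ ⊆ ball p r) {x : E}
    (hx : x ∈ frontier Ω ∩ ball p r) :
    ∫ τ : ℝ, Ω.indicator (fun z => fderiv ℝ φ z e) (τ • e + perpProj e x) = φ x := by
  set γ : ℝ → E := fun τ => τ • e + perpProj e x with hγ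
  have hγx : ∀ τ, γ τ = x + (τ - ⟪e, x⟫) • e := fun τ => by
    rw [hγ]; dsimp only; rw [coe_perpProj he, sub_smul]; abel
  have hγd : ∀ τ, HasDerivAt γ e τ := fun τ => by
    have := ((hasDerivAt_id τ).smul_const e).add_const ((perpProj e x : E))
    rwa [one_smul] at this
  have hd : ∀ τ, HasDerivAt (φ ∘ γ) (fderiv ℝ φ (γ τ) e) τ := fun τ =>
    ((hφ.differentiable one_ne_zero (γ τ)).hasFDerivAt).comp_hasDerivAt τ (hγd τ)
  have hγc : ContDiff ℝ 1 γ := by rw [hγ]; fun_prop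
  have hφc : HasCompactSupport φ :=
    Metric.isCompact_of_isClosed_isBounded (isClosed_tsupport φ) (isBounded_ball.subset hsupp)
  have hγe : IsClosedEmbedding γ := by
    have : Isometry γ := Isometry.of_dist_eq fun a b => by
      rw [dist_eq_norm, dist_eq_norm, hγx, hγx, add_sub_add_left_eq_sub, ← sub_smul, norm_smul,
        he, mul_one]
      congr 1; ring
    exact this.isClosedEmbedding
  have hcs : HasCompactSupport (φ ∘ γ) := hφc.comp_isClosedEmbedding hγe
  have h0 : g x = 0 := (hg x hx.2).1.1 hx.1
  -- Inside the ball `g` increases along the line, so `Ω` is exactly the part before `x`; outside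
  -- the ball the derivative vanishes. The fundamental theorem of calculus then leaves `φ x`.
  have key : (fun τ : ℝ => Ω.indicator (fun z => fderiv ℝ φ z e) (γ τ)) =
      (Iio ⟪e, x⟫).indicator (deriv (φ ∘ γ)) := by
    funext τ
    by_cases hV : γ τ ∈ ball p r
    · have hiff : γ τ ∈ Ω ↔ τ ∈ Iio ⟪e, x⟫ := by
        rw [(hg _ hV).2, mem_Iio]
        rcases lt_trichotomy τ ⟪e, x⟫ with h | h | h
        · have h3 : x = γ τ + (⟪e, x⟫ - τ) • e := by rw [hγx, add_assoc, ← add_smul]; simp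
          have h4 := hmono (γ τ) hV (⟪e, x⟫ - τ) (by linarith) (by rw [← h3]; exact hx.2)
          rw [← h3, h0] at h4
          exact iff_of_true h4 h
        · have : γ τ = x := by rw [hγx, h]; simp
          rw [this, h0]
          exact iff_of_false (lt_irrefl _) (by rw [h]; exact lt_irrefl _)
        · have h4 := hmono x hx.2 (τ - ⟪e, x⟫) (by linarith) (by rw [← hγx]; exact hV)
          rw [← hγx, h0] at h4
          exact iff_of_false h4.not_gt h.not_gt
      by_cases h : τ ∈ Iio ⟪e, x⟫
      · rw [indicator_of_mem (hiff.2 h), indicator_of_mem h, (hd τ).deriv]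
      · rw [indicator_of_notMem (fun h' => h (hiff.1 h')), indicator_of_notMem h]
    · have h1 : fderiv ℝ φ (γ τ) = 0 :=
        image_eq_zero_of_notMem_tsupport (fun h => hV (hsupp (tsupport_fderiv_subset ℝ h)))
      have h2 : deriv (φ ∘ γ) τ = 0 := by rw [(hd τ).deriv, h1]; rfl
      simp [indicator, h1, h2]
  change ∫ τ : ℝ, Ω.indicator (fun z => fderiv ℝ φ z e) (γ τ) = φ x
  rw [key, integral_indicator measurableSet_Iio, ← integral_Iic_eq_integral_Iio,
    hcs.integral_Iic_deriv_eq (hφ.comp hγc)]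
  simp [hγx]

variable [MeasurableSpace E] [BorelSpace E]

theorem measurePreserving_smul_add {e : E} (he : ‖e‖ = 1) :
    ∃ G : ℝ × (ℝ ∙ e)ᗮ ≃ᵐ E, MeasurePreserving G ∧ ∀ z, G z = z.1 • e + z.2 := by
  have h1 := ((ℝ ∙ e).measurePreserving_measurableEquivProd (0 : E)).symm
  rw [InnerProductSpace.euclideanHausdorffMeasure_eq_volume] at h1
  let T := LinearIsometryEquiv.toSpanUnitSingleton (𝕜 := ℝ) e he
  let G₁ : ℝ × (ℝ ∙ e)ᗮ ≃ᵐ (ℝ ∙ e) × (ℝ ∙ e)ᗮ :=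
    T.toMeasurableEquiv.prodCongr (MeasurableEquiv.refl _)
  have h2 : MeasurePreserving G₁ := T.measurePreserving.prod (MeasurePreserving.id _)
  refine ⟨G₁.trans ((ℝ ∙ e).measurableEquivProd (0 : E)).symm, h1.comp h2, fun z => ?_⟩
  have h3 : G₁ z = (T z.1, z.2) := rfl
  simp [h3, T]

/-- Fubini's theorem along the lines of direction `e`. -/
theorem integrable_and_integral_lines {e : E} (he : ‖e‖ = 1) {f : E → ℝ} (hf : Integrable f) :
    Integrable (fun y : (ℝ ∙ e)ᗮ => ∫ τ : ℝ, f (τ • e + y)) ∧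
      ∫ x, f x = ∫ y : (ℝ ∙ e)ᗮ, ∫ τ : ℝ, f (τ • e + y) := by
  obtain ⟨G, hG, hGz⟩ := measurePreserving_smul_add he
  have h1 : Integrable (fun z => f (G z)) := hG.integrable_comp_of_integrable hf
  have h2 : ∫ x, f x = ∫ z, f (G z) := (hG.integral_comp' f).symm
  simp_rw [hGz] at h1 h2
  exact ⟨h1.integral_prod_right, h2.trans (integral_prod_symm _ h1)⟩

/-- A transfer of integrals from the hyperplane `eᗮ` to a subset `W` on which the projection along
`e` nearly contracts the measure by a constant factor. -/
theorem integral_le_of_perpProj_image {k : ℕ} {e : E} {W : Set E} (hW : MeasurableSet W)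
    (hfin : μHE[k] W ≠ ⊤) {c K : ℝ} (hc : 0 < c) (hK : 0 < K)
    (hinj : InjOn (perpProj e) W)
    (h₁ : ∀ A ⊆ W, volume (perpProj e '' A) ≤ ENNReal.ofReal (c * K) * μHE[k] A)
    (h₂ : ∀ A ⊆ W, ENNReal.ofReal c * μHE[k] A ≤ ENNReal.ofReal K * volume (perpProj e '' A))
    {φ : E → ℝ} (hφ : Continuous φ) (hφc : HasCompactSupport φ) (hφ0 : ∀ x, 0 ≤ φ x)
    {ψ : (ℝ ∙ e)ᗮ → ℝ} (hψ : Integrable ψ) (hψW : ∀ x ∈ W, ψ (perpProj e x) = φ x)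
    (hψ0 : ∀ y ∉ perpProj e '' W, ψ y = 0) :
    ∫ y, ψ y ≤ c * K * ∫ x in W, φ x ∂μHE[k] ∧ c * ∫ x in W, φ x ∂μHE[k] ≤ K * ∫ y, ψ y := by
  have hψnn : ∀ y, 0 ≤ ψ y := by
    intro y
    by_cases hy : y ∈ perpProj e '' W
    · obtain ⟨x, hx, rfl⟩ := hy
      rw [hψW x hx]; exact hφ0 x
    · rw [hψ0 y hy]
  have hemb : MeasurableEmbedding (W.domRestrict (perpProj e)) :=
    (perpProj e).continuous.continuousOn.measurableEmbedding hW hinj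
  have hrange : range (W.domRestrict (perpProj e)) = perpProj e '' W := range_domRestrict _ _
  have hmW : MeasurableSet (perpProj e '' W) := hrange ▸ hemb.measurableSet_range
  -- The hypotheses on subsets of `W` compare two measures on the hyperplane: Lebesgue measure on
  -- the shadow of `W` and the push-forward of the Hausdorff measure. Integrals of `ψ` inherit the
  -- comparison.
  set ν₁ : Measure (ℝ ∙ e)ᗮ := volume.restrict (perpProj e '' W) with hν₁
  set ν₂ : Measure (ℝ ∙ e)ᗮ :=
    (Measure.comap ((↑) : W → E) μHE[k]).map (W.domRestrict (perpProj e)) with hν₂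
  have e₁ : ∀ B, MeasurableSet B → ν₁ B = volume (perpProj e '' (W ∩ perpProj e ⁻¹' B)) := by
    intro B hB
    rw [hν₁, Measure.restrict_apply hB, image_inter_preimage, inter_comm]
  have e₂ : ∀ B, MeasurableSet B → ν₂ B = μHE[k] (W ∩ perpProj e ⁻¹' B) := by
    intro B hB
    rw [hν₂, hemb.map_apply, comap_subtype_coe_apply hW]
    congr 1
    ext x
    simp [and_comm]
  have l₁ : ν₁ ≤ ENNReal.ofReal (c * K) • ν₂ := Measure.le_iff.2 fun B hB => by
    rw [Measure.smul_apply, e₁ B hB, e₂ B hB]; exact h₁ _ inter_subset_left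
  have l₂ : ENNReal.ofReal c • ν₂ ≤ ENNReal.ofReal K • ν₁ := Measure.le_iff.2 fun B hB => by
    rw [Measure.smul_apply, Measure.smul_apply, e₁ B hB, e₂ B hB]; exact h₂ _ inter_subset_left
  have i₁ : ∫⁻ y, ENNReal.ofReal (ψ y) = ∫⁻ y, ENNReal.ofReal (ψ y) ∂ν₁ := by
    rw [hν₁, setLIntegral_eq_of_support_subset]
    intro y hy
    by_contra h
    exact hy (by simp [hψ0 y h])
  have i₂ : ∫⁻ y, ENNReal.ofReal (ψ y) ∂ν₂ = ∫⁻ x in W, ENNReal.ofReal (φ x) ∂μHE[k] := by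
    rw [hν₂, hemb.lintegral_map, ← lintegral_subtype_comap hW]
    refine lintegral_congr fun x => ?_
    rw [domRestrict_apply, hψW x x.2]
  have j₁ : ∫⁻ y, ENNReal.ofReal (ψ y) ≤
      ENNReal.ofReal (c * K) * ∫⁻ x in W, ENNReal.ofReal (φ x) ∂μHE[k] := by
    rw [i₁, ← i₂, ← smul_eq_mul, ← lintegral_smul_measure]
    exact lintegral_mono' l₁ le_rfl
  have j₂ : ENNReal.ofReal c * ∫⁻ x in W, ENNReal.ofReal (φ x) ∂μHE[k] ≤
      ENNReal.ofReal K * ∫⁻ y, ENNReal.ofReal (ψ y) := by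
    rw [i₁, ← i₂, ← smul_eq_mul, ← smul_eq_mul, ← lintegral_smul_measure, ← lintegral_smul_measure]
    exact lintegral_mono' l₂ le_rfl
  have : IsFiniteMeasure (μHE[k].restrict W : Measure E) :=
    isFiniteMeasure_restrict.2 hfin
  have hφi : Integrable φ (μHE[k].restrict W) := hφ.integrable_of_hasCompactSupport hφc
  rw [← ofReal_integral_eq_lintegral_ofReal hψ (ae_of_all _ hψnn),
    ← ofReal_integral_eq_lintegral_ofReal hφi (ae_of_all _ hφ0)] at j₁ j₂
  have n₁ : 0 ≤ ∫ x in W, φ x ∂μHE[k] := integral_nonneg hφ0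
  have n₂ : 0 ≤ ∫ y, ψ y := integral_nonneg hψnn
  rw [← ENNReal.ofReal_mul (by positivity)] at j₁ j₂
  rw [← ENNReal.ofReal_mul (by positivity)] at j₂
  exact ⟨(ENNReal.ofReal_le_ofReal_iff (by positivity)).1 j₁,
    (ENNReal.ofReal_le_ofReal_iff (by positivity)).1 j₂⟩

end Local

/-! ### Local comparison of interior and boundary integrals -/

section LocalComparison

variable {E : Type*} [NormedAddCommGroup E] [InnerProductSpace ℝ E]

theorem perpProj_smul_add {e : E} (he : ‖e‖ = 1) (τ : ℝ) (y : (ℝ ∙ e)ᗮ) :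
    perpProj e (τ • e + y) = y := by
  have h1 : ⟪e, (y : E)⟫ = 0 := Submodule.mem_orthogonal_singleton_iff_inner_right.1 y.2
  apply Subtype.ext
  rw [coe_perpProj he, inner_add_right, h1, inner_smul_right, real_inner_self_eq_norm_sq, he]
  simp

theorem perpProj_add_smul {e : E} (he : ‖e‖ = 1) (x : E) (τ : ℝ) :
    perpProj e (x + τ • e) = perpProj e x := by
  have h1 := perpProj_smul_add he τ 0
  rw [Submodule.coe_zero, add_zero] at h1
  rw [map_add, h1, add_zero]

/-- Every line of direction `e` close to `p` meets the zero set of `g` near `p`. -/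
theorem exists_zero_on_line {n e p : E} (hn : ‖n‖ = 1) (he : ‖e‖ = 1) (hc : 0 < ⟪n, e⟫)
    {g : E → ℝ} {r : ℝ} (hr : 0 < r) (hp : g p = 0)
    (hg : ∀ x ∈ ball p r, ∀ y ∈ ball p r, |g x - g y - ⟪n, x - y⟫| ≤ ⟪n, e⟫ / 2 * ‖x - y‖) :
    ∃ δ > 0, δ < r ∧ ∀ z ∈ ball p δ, ∃ s : ℝ, z + s • e ∈ ball p r ∧ g (z + s • e) = 0 := by
  set c := ⟪n, e⟫ with hcdef
  have hc1 : c ≤ 1 := by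
    have := real_inner_le_norm n e
    rwa [hn, he, one_mul] at this
  have hnx : ∀ x, |⟪n, x⟫| ≤ ‖x‖ := fun x => by simpa [hn] using abs_real_inner_le_norm n x
  -- At `s = ± r / 2` the main term `± r * c / 2` must beat the error, which is below `r * c * (1/8
  -- + 1/16 + 1/4)` since `c ≤ 1`; the intermediate value theorem then gives the zero.
  refine ⟨r * c / 8, by positivity, by nlinarith, fun z hz => ?_⟩
  have hz' : ‖z - p‖ < r * c / 8 := by simpa [dist_eq_norm] using hz
  have hmem : ∀ s ∈ Icc (-(r / 2)) (r / 2), z + s • e ∈ ball p r := by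
    intro s hs
    rw [mem_ball, dist_eq_norm]
    have h1 : ‖s • e‖ ≤ r / 2 := by
      rw [norm_smul, he, mul_one, Real.norm_eq_abs]; exact abs_le.2 hs
    calc ‖z + s • e - p‖ = ‖(z - p) + s • e‖ := by congr 1; abel
      _ ≤ ‖z - p‖ + ‖s • e‖ := norm_add_le _ _
      _ < r := by nlinarith
  have hcont : ContinuousOn (fun s : ℝ => g (z + s • e)) (Icc (-(r / 2)) (r / 2)) := by
    have h1 : LipschitzOnWith 2 g (ball p r) := by
      refine LipschitzOnWith.of_dist_le_mul fun x hx y hy => ?_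
      rw [dist_eq_norm, dist_eq_norm, Real.norm_eq_abs]
      have h2 := abs_le.1 (hg x hx y hy)
      have h3 := abs_le.1 (hnx (x - y))
      have h4 := norm_nonneg (x - y)
      rw [NNReal.coe_ofNat, abs_le]
      constructor <;> nlinarith
    exact h1.continuousOn.comp (by fun_prop) hmem
  have hval : ∀ s ∈ Icc (-(r / 2)) (r / 2), |g (z + s • e) - s * c| ≤
      ‖z - p‖ + c / 2 * (‖z - p‖ + |s|) := by
    intro s hs
    have h1 := hg _ (hmem s hs) p (mem_ball_self hr)
    have h2 : z + s • e - p = (z - p) + s • e := by abel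
    rw [hp, sub_zero, h2, inner_add_right, inner_smul_right, ← hcdef] at h1
    have h3 : ‖(z - p) + s • e‖ ≤ ‖z - p‖ + |s| := by
      refine (norm_add_le _ _).trans ?_
      rw [norm_smul, he, mul_one, Real.norm_eq_abs]
    have h4 := abs_le.1 (hnx (z - p))
    have h5 := abs_le.1 (h1.trans (mul_le_mul_of_nonneg_left h3 (by positivity)))
    rw [abs_le]
    constructor <;> linarith
  have hr2 : -(r / 2) ≤ r / 2 := by linarith
  have hlo := (abs_le.1 (hval (-(r / 2)) ⟨le_rfl, hr2⟩)).2
  have hhi := (abs_le.1 (hval (r / 2) ⟨hr2, le_rfl⟩)).1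
  rw [abs_neg, abs_of_pos (by positivity)] at hlo
  rw [abs_of_pos (by positivity)] at hhi
  have hb : ‖z - p‖ + c / 2 * (‖z - p‖ + r / 2) < r / 2 * c := by
    have : c / 2 * ‖z - p‖ ≤ 1 / 2 * ‖z - p‖ := by gcongr
    nlinarith [norm_nonneg (z - p)]
  obtain ⟨s, hs, hs0⟩ := intermediate_value_Icc hr2 hcont
    (show (0 : ℝ) ∈ Icc _ _ from ⟨by linarith, by linarith⟩)
  exact ⟨s, hmem s hs, hs0⟩

variable [FiniteDimensional ℝ E] [MeasurableSpace E] [BorelSpace E]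

/-- Near a boundary point of `Ω` with outer normal `n`, the integrals `∫_Ω ∂ₑφ` and
`⟪n, e⟫ ∫_{∂Ω} φ` are nearly equal, for `e` transversal to the boundary. -/
theorem exists_ball_integral_comparison {k : ℕ} (hk : finrank ℝ E = k + 1) {Ω : Set E}
    (hΩ : MeasurableSet Ω) {n p : E} (hp : p ∈ frontier Ω) (hn : ‖n‖ = 1)
    (h : IsOuterNormal Ω n p) {e : E} (he : ‖e‖ = 1) (hc : 0 < ⟪n, e⟫) {K : ℝ} (hK : 1 < K) :
    μHE[k] (frontier Ω) ≠ 0 ∧ ∃ δ > 0, μHE[k] (frontier Ω ∩ ball p δ) ≠ ⊤ ∧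
      ∀ φ : E → ℝ, ContDiff ℝ 1 φ → tsupport φ ⊆ ball p δ → (∀ x, 0 ≤ φ x) →
        ∫ x in Ω, fderiv ℝ φ x e ≤ ⟪n, e⟫ * K * ∫ x in frontier Ω, φ x ∂μHE[k] ∧
        ⟪n, e⟫ * ∫ x in frontier Ω, φ x ∂μHE[k] ≤ K * ∫ x in Ω, fderiv ℝ φ x e := by
  obtain ⟨η, hη, hA⟩ := exists_forall_volume_perpProj_image hk hn he hc.ne' hK
  rw [abs_of_pos hc] at hA
  set c := ⟪n, e⟫ with hcdef
  -- The bound `η` makes the frontier flat enough for the area estimate; the bound `c / 2` makes `g`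
  -- increase along `e` and forces nearby lines to meet the frontier.
  obtain ⟨g, r, hr, hg, hgd⟩ := h.exists_ball (η := min η (c / 2)) (lt_min hη (by positivity))
  have hp0 : g p = 0 := ((hg p (mem_ball_self hr)).1).1 hp
  obtain ⟨δ, hδ, hδr, hz⟩ := exists_zero_on_line hn he hc hr hp0 fun x hx y hy =>
    (hgd x hx y hy).trans (by gcongr; exact min_le_right _ _)
  set W := frontier Ω ∩ ball p r with hWdef
  have hW : MeasurableSet W := isClosed_frontier.measurableSet.inter measurableSet_ball
  have hWA : ∀ x ∈ W, ∀ y ∈ W, |⟪n, x - y⟫| ≤ η * ‖x - y‖ := by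
    intro x hx y hy
    have h1 := hgd x hx.2 y hy.2
    rw [((hg x hx.2).1).1 hx.1, ((hg y hy.2).1).1 hy.1, sub_zero, zero_sub, abs_neg] at h1
    exact h1.trans (by gcongr; exact min_le_left _ _)
  have hAW : ∀ A ⊆ W, _ := fun A hAW => (hA A fun x hx y hy => hWA x (hAW hx) y (hAW hy)).2
  -- This serves twice: the shadow of `W` contains an open set, so `W` has positive measure, and a
  -- line that misses `W` also misses the support of `φ`.
  have hmeet : ∀ z ∈ ball p δ, perpProj e z ∈ perpProj e '' W := by
    intro z hzδ
    obtain ⟨s, hs, hs0⟩ := hz z hzδ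
    exact ⟨z + s • e, ⟨((hg _ hs).1).2 hs0, hs⟩, perpProj_add_smul he z s⟩
  have hfin : μHE[k] W ≠ ⊤ := by
    have h1 : volume (perpProj e '' W) < ⊤ := by
      refine (measure_mono (image_mono ?_)).trans_lt
        (((isCompact_closedBall p r).image (perpProj e).continuous).measure_lt_top)
      exact inter_subset_right.trans ball_subset_closedBall
    intro h2
    have h3 := (hAW W subset_rfl).2
    rw [h2, ENNReal.mul_top (by simpa using hc), top_le_iff] at h3
    exact ENNReal.mul_ne_top ENNReal.ofReal_ne_top h1.ne h3
  have hpos : μHE[k] W ≠ 0 := by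
    intro h0
    have h1 := (hAW W subset_rfl).1
    rw [h0, mul_zero, nonpos_iff_eq_zero] at h1
    have hopen : IsOpen (perpProj e '' ball p δ) := by
      refine (perpProj e).isOpenMap (fun y => ⟨y, ?_⟩) _ isOpen_ball
      have := perpProj_smul_add he 0 y
      rwa [zero_smul, zero_add] at this
    refine (hopen.measure_pos volume ⟨_, mem_image_of_mem _ (mem_ball_self hδ)⟩).ne' ?_
    exact measure_mono_null (by rintro _ ⟨z, hz, rfl⟩; exact hmeet z hz) h1
  refine ⟨fun h0 => hpos (measure_mono_null inter_subset_left h0), δ, hδ, ?_, ?_⟩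
  · exact fun h0 => hfin (top_le_iff.1 (h0 ▸ measure_mono
      (inter_subset_inter_right _ (ball_subset_ball hδr.le))))
  intro φ hφ hsupp hφ0
  have hsupp' : tsupport φ ⊆ ball p r := hsupp.trans (ball_subset_ball hδr.le)
  have hφc : HasCompactSupport φ :=
    Metric.isCompact_of_isClosed_isBounded (isClosed_tsupport φ) (isBounded_ball.subset hsupp)
  have hdi : Integrable (fun x => fderiv ℝ φ x e) :=
    ((hφ.continuous_fderiv one_ne_zero).clm_apply continuous_const).integrable_of_hasCompactSupport
      (hφc.fderiv_apply ℝ e)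
  obtain ⟨hψ, hψI⟩ := integrable_and_integral_lines he (hdi.indicator hΩ)
  rw [integral_indicator hΩ] at hψI
  have hmono : ∀ x ∈ ball p r, ∀ τ > (0 : ℝ), x + τ • e ∈ ball p r → g x < g (x + τ • e) := by
    intro x hx τ hτ hx'
    have h1 := hgd _ hx' x hx
    rw [add_sub_cancel_left, inner_smul_right, norm_smul, he, mul_one, Real.norm_eq_abs,
      abs_of_pos hτ] at h1
    have h2 := (abs_le.1 (h1.trans (mul_le_mul_of_nonneg_right (min_le_right _ _) hτ.le))).1
    nlinarith
  have hIW : ∫ x in frontier Ω, φ x ∂μHE[k] = ∫ x in W, φ x ∂μHE[k] := by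
    rw [← integral_indicator isClosed_frontier.measurableSet, ← integral_indicator hW]
    congr 1
    funext x
    by_cases hx : x ∈ tsupport φ
    · by_cases h1 : x ∈ frontier Ω
      · rw [indicator_of_mem h1, indicator_of_mem (s := W) ⟨h1, hsupp' hx⟩]
      · rw [indicator_of_notMem h1, indicator_of_notMem (s := W) fun h => h1 h.1]
    · simp [indicator, image_eq_zero_of_notMem_tsupport hx]
  rw [hψI, hIW]
  refine integral_le_of_perpProj_image hW hfin hc (by linarith) (hA W hWA).1
    (fun A h => (hAW A h).1) (fun A h => (hAW A h).2) hφ.continuous hφc hφ0 hψ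
    (fun x hx => integral_line_indicator he hg hmono hφ hsupp' hx) fun y hy => ?_
  refine integral_eq_zero_of_ae (ae_of_all _ fun τ => ?_)
  have h1 : fderiv ℝ φ (τ • e + y) = 0 := by
    refine image_eq_zero_of_notMem_tsupport fun hmem => hy ?_
    have := hmeet _ (hsupp (tsupport_fderiv_subset ℝ hmem))
    rwa [perpProj_smul_add he] at this
  simp [indicator, h1]

end LocalComparison

/-! ### The global cancellation of interior integrals -/

section Frontier

theorem subset_or_subset_compl_of_disjoint_frontier {X : Type*} [TopologicalSpace X] {C Ω : Set X}
    (hC : IsPreconnected C) (h : Disjoint C (frontier Ω)) : C ⊆ Ω ∨ C ⊆ Ωᶜ := by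
  have h1 : C ⊆ interior Ω ∪ (closure Ω)ᶜ := by
    intro x hx
    by_contra hcon
    rw [mem_union, not_or, mem_compl_iff, not_not] at hcon
    exact disjoint_left.1 h hx ⟨hcon.2, hcon.1⟩
  have h2 : C ∩ (interior Ω ∩ (closure Ω)ᶜ) = ∅ := by
    refine eq_empty_of_forall_notMem fun x hx => hx.2.2 (subset_closure (interior_subset hx.2.1))
  rcases isPreconnected_iff_subset_of_disjoint.1 hC _ _ isOpen_interior
    isClosed_closure.isOpen_compl h1 h2 with h3 | h3
  · exact Or.inl (h3.trans interior_subset)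
  · exact Or.inr (h3.trans (compl_subset_compl.2 subset_closure))

variable {E : Type*} [NormedAddCommGroup E] [NormedSpace ℝ E]

/-- Polar coordinates present the set as a continuous image of a ray times a sphere, which is
connected in dimension at least two. It shows that a set with compact frontier either contains or
misses a neighbourhood of infinity. -/
theorem isPreconnected_setOf_lt_norm (hE : 1 < Module.rank ℝ E) {R : ℝ} (hR : 0 ≤ R) :
    IsPreconnected {x : E | R < ‖x‖} := by
  have h1 := ((isPreconnected_Ioi (a := R)).prod (isPreconnected_sphere hE (0 : E) 1)).image
    (fun z : ℝ × E => z.1 • z.2) (by fun_prop)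
  convert h1 using 1
  ext x
  constructor
  · intro hx
    have hx : R < ‖x‖ := hx
    have h0 : ‖x‖ ≠ 0 := (hR.trans_lt hx).ne'
    refine ⟨(‖x‖, ‖x‖⁻¹ • x), ⟨hx, ?_⟩, ?_⟩
    · simp [norm_smul, h0]
    · simp [smul_smul, h0]
  · rintro ⟨⟨r, v⟩, ⟨hr, hv⟩, rfl⟩
    have hr : R < r := hr
    have hv : ‖v‖ = 1 := by simpa using hv
    change R < ‖r • v‖
    rw [norm_smul, hv, mul_one, Real.norm_eq_abs]
    exact hr.trans_le (le_abs_self _)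

variable [FiniteDimensional ℝ E] [MeasurableSpace E] [BorelSpace E]

/-- The integral over `Ω` of a directional derivative of a cutoff function `ψ` that is `1` near
the boundary of `Ω` is zero. -/
theorem setIntegral_fderiv_eq_zero (hE : 1 < Module.rank ℝ E) (μ : Measure E)
    [μ.IsAddHaarMeasure] {Ω : Set E} (hΩ : MeasurableSet Ω)
    (hS : IsCompact (frontier Ω)) {ψ : E → ℝ} (hψ : ContDiff ℝ 1 ψ) (hψc : HasCompactSupport ψ)
    (hψ1 : ∀ p ∈ frontier Ω, ∀ᶠ x in 𝓝 p, ψ x = 1) (w : E) :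
    ∫ x in Ω, fderiv ℝ ψ x w ∂μ = 0 := by
  obtain ⟨R, hR0, hR⟩ : ∃ R : ℝ, 0 ≤ R ∧ frontier Ω ⊆ closedBall 0 R := by
    obtain ⟨R, hR⟩ := hS.isBounded.subset_closedBall 0
    exact ⟨max R 0, le_max_right _ _, hR.trans (closedBall_subset_closedBall (le_max_left _ _))⟩
  set χ : E → ℝ := Ω.indicator 1 with hχ
  obtain ⟨κ, hκ⟩ : ∃ κ : ℝ, ∀ x, R < ‖x‖ → χ x = κ := by
    rcases subset_or_subset_compl_of_disjoint_frontier (isPreconnected_setOf_lt_norm hE hR0)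
      (Ω := Ω) (disjoint_left.2 fun x hx hx' => by
        have h1 := hR hx'
        rw [mem_closedBall_zero_iff] at h1
        exact h1.not_gt hx) with h | h
    · exact ⟨1, fun x hx => by rw [hχ, indicator_of_mem (h hx)]; rfl⟩
    · exact ⟨0, fun x hx => by rw [hχ, indicator_of_notMem (h hx)]⟩
  -- The first factor removes the jump of `χ` at the frontier and the second vanishes near infinity,
  -- so `u` is differentiable with compact support. Since `∫ ∂u = 0` and `∂u = (χ - κ) ∂ψ`, the
  -- claim follows from `∫ ∂ψ = 0`.
  set u : E → ℝ := fun x => (ψ x - 1) * (χ x - κ) with hu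
  have hψd := hψ.differentiable one_ne_zero
  have hloc : ∀ x ∉ frontier Ω, χ =ᶠ[𝓝 x] fun _ => χ x := by
    intro x hx
    by_cases h1 : x ∈ closure Ω
    · have h2 : x ∈ interior Ω := by by_contra h; exact hx ⟨h1, h⟩
      filter_upwards [isOpen_interior.mem_nhds h2] with y hy
      rw [hχ, indicator_of_mem (interior_subset hy), indicator_of_mem (interior_subset h2)]
      rfl
    · filter_upwards [isClosed_closure.isOpen_compl.mem_nhds h1] with y hy
      rw [hχ, indicator_of_notMem (fun h => hy (subset_closure h)),
        indicator_of_notMem (fun h => h1 (subset_closure h))]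
  have hud : ∀ x, HasFDerivAt u ((χ x - κ) • fderiv ℝ ψ x) x := by
    intro x
    by_cases hx : x ∈ frontier Ω
    · have h1 : u =ᶠ[𝓝 x] fun _ => 0 := by
        filter_upwards [hψ1 x hx] with y hy
        simp [hu, hy]
      have h2 : fderiv ℝ ψ x = 0 := by
        have h3 : ψ =ᶠ[𝓝 x] fun _ => 1 := hψ1 x hx
        rw [h3.fderiv_eq]; simp
      rw [h2, smul_zero]
      exact (hasFDerivAt_const 0 x).congr_of_eventuallyEq h1
    · have h1 : u =ᶠ[𝓝 x] fun y => (ψ y - 1) * (χ x - κ) := by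
        filter_upwards [hloc x hx] with y hy
        simp [hu, hy]
      exact (((hψd x).hasFDerivAt.sub_const 1).mul_const _).congr_of_eventuallyEq h1
  have hudiff : Differentiable ℝ u := fun x => (hud x).differentiableAt
  have huc : HasCompactSupport u := by
    refine HasCompactSupport.intro (isCompact_closedBall (0 : E) R) fun x hx => ?_
    rw [mem_closedBall_zero_iff, not_le] at hx
    simp [hu, hκ x hx]
  have hdi : Integrable (fun x => fderiv ℝ ψ x w) μ :=
    ((hψ.continuous_fderiv one_ne_zero).clm_apply continuous_const).integrable_of_hasCompactSupport
      (hψc.fderiv_apply ℝ w)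
  have hfd : (fun x => fderiv ℝ u x w) =
      fun x => Ω.indicator (fun x => fderiv ℝ ψ x w) x - κ * fderiv ℝ ψ x w := by
    funext x
    rw [(hud x).fderiv, smul_apply, smul_eq_mul, sub_mul, hχ]
    by_cases hx : x ∈ Ω
    · simp [hx]
    · simp [hx]
  have hint : Integrable (fun x => fderiv ℝ u x w) μ := by
    rw [hfd]; exact (hdi.indicator hΩ).sub (hdi.const_mul κ)
  have hzero : ∀ f : E → ℝ, Differentiable ℝ f → Integrable f μ →
      Integrable (fun x => fderiv ℝ f x w) μ → ∫ x, fderiv ℝ f x w ∂μ = 0 := by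
    intro f hf hfi hfi'
    have := integral_mul_fderiv_eq_neg_fderiv_mul_of_integrable (μ := μ) (f := fun _ : E => (1 : ℝ))
      (g := f) (v := w) (by simp) (by simpa using hfi') (by simpa using hfi)
      (fun _ _ => differentiableAt_const 1) (fun _ _ => hf _)
    simpa using this
  have h1 := hzero u hudiff (hudiff.continuous.integrable_of_hasCompactSupport huc) hint
  have h2 := hzero ψ hψd (hψ.continuous.integrable_of_hasCompactSupport hψc) hdi
  rw [hfd, integral_sub (hdi.indicator hΩ) (hdi.const_mul κ), integral_const_mul, h2,
    integral_indicator hΩ, mul_zero, sub_zero] at h1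
  exact h1

end Frontier

/-! ### The divergence theorem for constant fields -/

section Divergence

variable {E : Type*} [NormedAddCommGroup E] [InnerProductSpace ℝ E] [MeasurableSpace E] [BorelSpace E]

theorem integrableOn_mul_inner_normal {k : ℕ} {S : Set E} (hSm : MeasurableSet S)
    {n : E → E} (hnc : ContinuousOn n S) (hn1 : ∀ p ∈ S, ‖n p‖ = 1)
    {φ : E → ℝ} (hφ : IntegrableOn φ S μHE[k]) (w : E) :
    IntegrableOn (fun x => φ x * ⟪n x, w⟫) S μHE[k] := by
  refine hφ.mul_bdd (c := ‖w‖) ?_ ?_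
  · exact (ContinuousOn.inner hnc continuousOn_const).aestronglyMeasurable hSm
  · refine (ae_restrict_iff' hSm).2 (ae_of_all _ fun x hx => ?_)
    simpa [hn1 x hx] using norm_inner_le_norm (𝕜 := ℝ) (n x) w

variable [FiniteDimensional ℝ E]

/-- Compactness reduces this to the local finiteness contained in `exists_ball_integral_comparison`,
applied in the direction of the normal itself. -/
theorem euclideanHausdorffMeasure_frontier_lt_top {k : ℕ} (hk : finrank ℝ E = k + 1) {Ω : Set E}
    (hΩ : MeasurableSet Ω) (hS : IsCompact (frontier Ω)) {n : E → E}
    (hn1 : ∀ p ∈ frontier Ω, ‖n p‖ = 1) (hn : ∀ p ∈ frontier Ω, IsOuterNormal Ω (n p) p) :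
    μHE[k] (frontier Ω) < ⊤ := by
  refine hS.measure_lt_top_of_nhdsWithin fun p hp => ?_
  have hc : 0 < ⟪n p, n p⟫ := by rw [real_inner_self_eq_norm_sq, hn1 p hp]; norm_num
  obtain ⟨-, δ, hδ, h1, -⟩ := exists_ball_integral_comparison hk hΩ hp (hn1 p hp) (hn p hp)
    (hn1 p hp) hc one_lt_two
  exact ⟨_, inter_mem self_mem_nhdsWithin (mem_nhdsWithin_of_mem_nhds (ball_mem_nhds p hδ)),
    h1.lt_top⟩

/-- Half of the error comes from the factor `K = 1 + ε / 2` in the local comparison, the other half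
from replacing `n p` by `n x`, which continuity of `n` controls. -/
theorem exists_ball_integral_error_of_inner_pos {k : ℕ} (hk : finrank ℝ E = k + 1) {Ω : Set E}
    (hΩ : MeasurableSet Ω) {n : E → E} (hnc : ContinuousOn n (frontier Ω))
    (hn1 : ∀ p ∈ frontier Ω, ‖n p‖ = 1) (hn : ∀ p ∈ frontier Ω, IsOuterNormal Ω (n p) p)
    (hfin : μHE[k] (frontier Ω) < ⊤) {p : E} (hp : p ∈ frontier Ω) {e : E} (he : ‖e‖ = 1)
    (hc : 0 < ⟪n p, e⟫) {ε : ℝ} (hε : 0 < ε) :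
    ∃ δ > 0, ∀ φ : E → ℝ, ContDiff ℝ 1 φ → tsupport φ ⊆ ball p δ → (∀ x, 0 ≤ φ x) →
      |(∫ x in Ω, fderiv ℝ φ x e) - ∫ x in frontier Ω, φ x * ⟪n x, e⟫ ∂μHE[k]| ≤
        ε * ∫ x in frontier Ω, φ x ∂μHE[k] := by
  obtain ⟨-, δ₁, hδ₁, -, h1⟩ := exists_ball_integral_comparison hk hΩ hp (hn1 p hp) (hn p hp)
    he hc (show 1 < 1 + ε / 2 by linarith)
  obtain ⟨δ₂, hδ₂, h2⟩ := Metric.continuousOn_iff.1 hnc p hp (ε / 2) (by positivity)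
  refine ⟨min δ₁ δ₂, lt_min hδ₁ hδ₂, fun φ hφ hsupp hφ0 => ?_⟩
  obtain ⟨hup, hlo⟩ := h1 φ hφ (hsupp.trans (ball_subset_ball (min_le_left _ _))) hφ0
  have hSm : MeasurableSet (frontier Ω) := isClosed_frontier.measurableSet
  have hφc : HasCompactSupport φ :=
    Metric.isCompact_of_isClosed_isBounded (isClosed_tsupport φ) (isBounded_ball.subset hsupp)
  have : IsFiniteMeasure (μHE[k].restrict (frontier Ω)) := isFiniteMeasure_restrict.2 hfin.ne
  have hφi : IntegrableOn φ (frontier Ω) μHE[k] := hφ.continuous.integrable_of_hasCompactSupport hφc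
  have hφn := integrableOn_mul_inner_normal hSm hnc hn1 hφi e
  set c := ⟪n p, e⟫ with hcdef
  set A := ∫ x in frontier Ω, φ x ∂μHE[k] with hA
  set I := ∫ x in Ω, fderiv ℝ φ x e
  have hA0 : 0 ≤ A := integral_nonneg hφ0
  have hc1 : c ≤ 1 := by
    have := real_inner_le_norm (n p) e
    rwa [hn1 p hp, he, one_mul] at this
  have hcA : c * A ≤ A := mul_le_of_le_one_left hA0 hc1
  have hcA0 : 0 ≤ c * A := by positivity
  have h3 : |I - c * A| ≤ ε / 2 * A := by
    rw [abs_le]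
    constructor
    · have h4 : c * A * (1 - ε / 2) ≤ I := by
        by_contra hcon
        push Not at hcon
        have h5 : (1 + ε / 2) * I < (1 + ε / 2) * (c * A * (1 - ε / 2)) := by gcongr
        have h6 : (1 + ε / 2) * (c * A * (1 - ε / 2)) = c * A - (ε / 2) ^ 2 * (c * A) := by ring
        nlinarith [mul_nonneg (sq_nonneg (ε / 2)) hcA0]
      nlinarith
    · nlinarith
  have h4 : |c * A - ∫ x in frontier Ω, φ x * ⟪n x, e⟫ ∂μHE[k]| ≤ ε / 2 * A := by
    rw [hA, ← integral_const_mul, ← integral_sub (hφi.const_mul c) hφn, ← integral_const_mul,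
      ← Real.norm_eq_abs]
    refine norm_integral_le_of_norm_le (μ := μHE[k].restrict (frontier Ω)) (hφi.const_mul (ε / 2))
      ((ae_restrict_iff' hSm).2 (ae_of_all _ fun x hx => ?_))
    by_cases hx' : x ∈ tsupport φ
    · have h5 := h2 x hx (lt_of_lt_of_le (hsupp hx') (min_le_right _ _))
      have h6 : c * φ x - φ x * ⟪n x, e⟫ = φ x * ⟪n p - n x, e⟫ := by
        rw [inner_sub_left, ← hcdef]; ring
      have h7 : |⟪n p - n x, e⟫| ≤ ε / 2 := by
        refine (abs_real_inner_le_norm _ _).trans ?_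
        rw [he, mul_one, ← dist_eq_norm, dist_comm]
        exact h5.le
      rw [h6, norm_mul, Real.norm_eq_abs, Real.norm_eq_abs, abs_of_nonneg (hφ0 x), mul_comm]
      exact mul_le_mul_of_nonneg_right h7 (hφ0 x)
    · simp [image_eq_zero_of_notMem_tsupport hx']
  calc _ = |(I - c * A) + (c * A - ∫ x in frontier Ω, φ x * ⟪n x, e⟫ ∂μHE[k])| := by
        congr 1; ring
    _ ≤ _ := abs_add_le _ _
    _ ≤ ε / 2 * A + ε / 2 * A := add_le_add h3 h4
    _ = ε * A := by ring

/-- Both integrals are linear in the direction, and any `w` in the unit ball is a combination of two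
directions transversal to the boundary: `n p` and the unit vector along `2 • n p + w`. -/
theorem exists_ball_integral_error {k : ℕ} (hk : finrank ℝ E = k + 1) {Ω : Set E}
    (hΩ : MeasurableSet Ω) {n : E → E} (hnc : ContinuousOn n (frontier Ω))
    (hn1 : ∀ p ∈ frontier Ω, ‖n p‖ = 1) (hn : ∀ p ∈ frontier Ω, IsOuterNormal Ω (n p) p)
    (hfin : μHE[k] (frontier Ω) < ⊤) {p : E} (hp : p ∈ frontier Ω) {w : E} (hw : ‖w‖ ≤ 1)
    {ε : ℝ} (hε : 0 < ε) :
    ∃ δ > 0, ∀ φ : E → ℝ, ContDiff ℝ 1 φ → tsupport φ ⊆ ball p δ → (∀ x, 0 ≤ φ x) →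
      |(∫ x in Ω, fderiv ℝ φ x w) - ∫ x in frontier Ω, φ x * ⟪n x, w⟫ ∂μHE[k]| ≤
        ε * ∫ x in frontier Ω, φ x ∂μHE[k] := by
  have hnn : ⟪n p, n p⟫ = 1 := by rw [real_inner_self_eq_norm_sq, hn1 p hp]; norm_num
  set v := (2 : ℝ) • n p + w with hv
  have hnv : 1 ≤ ⟪n p, v⟫ := by
    have h1 := (abs_le.1 (abs_real_inner_le_norm (n p) w)).1
    rw [hn1 p hp, one_mul] at h1
    rw [hv, inner_add_right, inner_smul_right, hnn]
    linarith
  set ρ := ‖v‖ with hρ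
  have hρ1 : 1 ≤ ρ := by
    have := real_inner_le_norm (n p) v
    rw [hn1 p hp, one_mul] at this
    linarith
  have hρ3 : ρ ≤ 3 := by
    calc ρ ≤ ‖(2 : ℝ) • n p‖ + ‖w‖ := norm_add_le _ _
      _ ≤ 2 + 1 := by rw [norm_smul, hn1 p hp]; norm_num; linarith
      _ = 3 := by norm_num
  have hρ0 : 0 < ρ := by linarith
  set e := ρ⁻¹ • v with he
  have hwe : w = ρ • e - (2 : ℝ) • n p := by
    rw [he, smul_smul, mul_inv_cancel₀ hρ0.ne', one_smul, hv, add_sub_cancel_left]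
  have he1 : ‖e‖ = 1 := by
    rw [he, norm_smul, norm_inv, norm_norm, ← hρ, inv_mul_cancel₀ hρ0.ne']
  -- The coefficients in `w = ρ • e - 2 • n p` add up in absolute value to at most `3 + 2 = 5`.
  obtain ⟨δ₁, hδ₁, h1⟩ := exists_ball_integral_error_of_inner_pos hk hΩ hnc hn1 hn hfin hp he1
    (by rw [he, inner_smul_right]; positivity) (show 0 < ε / 5 by positivity)
  obtain ⟨δ₂, hδ₂, h2⟩ := exists_ball_integral_error_of_inner_pos hk hΩ hnc hn1 hn hfin hp
    (hn1 p hp) (by rw [hnn]; exact one_pos) (show 0 < ε / 5 by positivity)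
  refine ⟨min δ₁ δ₂, lt_min hδ₁ hδ₂, fun φ hφ hsupp hφ0 => ?_⟩
  have j1 := h1 φ hφ (hsupp.trans (ball_subset_ball (min_le_left _ _))) hφ0
  have j2 := h2 φ hφ (hsupp.trans (ball_subset_ball (min_le_right _ _))) hφ0
  have hSm : MeasurableSet (frontier Ω) := isClosed_frontier.measurableSet
  have hφc : HasCompactSupport φ :=
    Metric.isCompact_of_isClosed_isBounded (isClosed_tsupport φ) (isBounded_ball.subset hsupp)
  have : IsFiniteMeasure (μHE[k].restrict (frontier Ω)) := isFiniteMeasure_restrict.2 hfin.ne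
  have hφi : IntegrableOn φ (frontier Ω) μHE[k] := hφ.continuous.integrable_of_hasCompactSupport hφc
  have hdi : ∀ u, IntegrableOn (fun x => fderiv ℝ φ x u) Ω := fun u =>
    (((hφ.continuous_fderiv one_ne_zero).clm_apply
      continuous_const).integrable_of_hasCompactSupport (hφc.fderiv_apply ℝ u)).integrableOn
  have hni := fun u => integrableOn_mul_inner_normal hSm hnc hn1 hφi u
  have k1 : ∫ x in Ω, fderiv ℝ φ x w =
      ρ * (∫ x in Ω, fderiv ℝ φ x e) - 2 * ∫ x in Ω, fderiv ℝ φ x (n p) := by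
    rw [← integral_const_mul, ← integral_const_mul,
      ← integral_sub ((hdi e).const_mul _) ((hdi (n p)).const_mul _)]
    congr 1
    funext x
    conv_lhs => rw [hwe]
    simp
  have k2 : ∫ x in frontier Ω, φ x * ⟪n x, w⟫ ∂μHE[k] =
      ρ * (∫ x in frontier Ω, φ x * ⟪n x, e⟫ ∂μHE[k]) -
        2 * ∫ x in frontier Ω, φ x * ⟪n x, n p⟫ ∂μHE[k] := by
    rw [← integral_const_mul, ← integral_const_mul,
      ← integral_sub ((hni e).const_mul _) ((hni (n p)).const_mul _)]
    congr 1
    funext x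
    conv_lhs => rw [hwe]
    rw [inner_sub_right, real_inner_smul_right _ e, real_inner_smul_right _ (n p)]
    ring
  have hA0 : 0 ≤ ∫ x in frontier Ω, φ x ∂μHE[k] := integral_nonneg hφ0
  rw [k1, k2]
  set A := ∫ x in frontier Ω, φ x ∂μHE[k]
  have j3 := mul_le_mul_of_nonneg_left j1 hρ0.le
  rw [← abs_of_pos hρ0, ← abs_mul, abs_of_pos hρ0] at j3
  have j4 : ρ * (ε / 5 * A) ≤ 3 * (ε / 5 * A) := by gcongr
  rw [abs_le] at j2 j3 ⊢
  constructor <;> linarith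

/-- The **divergence theorem** for constant vector fields on an open set with compact boundary of
class `C¹`: the integral of the outer unit normal over the boundary is zero. -/
theorem integral_inner_outerNormal_eq_zero {k : ℕ} (hk : finrank ℝ E = k + 1) (hk1 : 1 ≤ k)
    {Ω : Set E} (hΩ : MeasurableSet Ω) (hS : IsCompact (frontier Ω)) {n : E → E}
    (hnc : ContinuousOn n (frontier Ω)) (hn1 : ∀ p ∈ frontier Ω, ‖n p‖ = 1)
    (hn : ∀ p ∈ frontier Ω, IsOuterNormal Ω (n p) p) {w : E} (hw : ‖w‖ ≤ 1) :
    ∫ x in frontier Ω, ⟪n x, w⟫ ∂μHE[k] = 0 := by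
  have hfin := euclideanHausdorffMeasure_frontier_lt_top hk hΩ hS hn1 hn
  have hfm : IsFiniteMeasure (μHE[k].restrict (frontier Ω)) := isFiniteMeasure_restrict.2 hfin.ne
  have hSm : MeasurableSet (frontier Ω) := isClosed_frontier.measurableSet
  have key : ∀ ε > 0, |∫ x in frontier Ω, ⟪n x, w⟫ ∂μHE[k]| ≤ ε * μHE[k].real (frontier Ω) := by
    intro ε hε
    have hex := fun p (hp : p ∈ frontier Ω) =>
      exists_ball_integral_error hk hΩ hnc hn1 hn hfin hp hw hε
    choose! δ hδ herr using hex
    obtain ⟨t, ht, hcov⟩ := hS.elim_nhds_subcover (fun p => ball p (δ p))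
      fun p hp => ball_mem_nhds p (hδ p hp)
    -- The partition must sum to one on a neighbourhood of the frontier, not merely on it, for
    -- `setIntegral_fderiv_eq_zero` to apply.
    obtain ⟨C, hC, hSC, hCt⟩ := exists_compact_between hS
      (isOpen_biUnion fun p (_ : p ∈ t) => isOpen_ball (x := p) (ε := δ p)) hcov
    obtain ⟨f, hf⟩ := SmoothPartitionOfUnity.exists_isSubordinate (modelWithCornersSelf ℝ E)
      hC.isClosed (fun p : t => ball (p : E) (δ p)) (fun p => isOpen_ball)
      (by rwa [iUnion_subtype])
    have hfC : ∀ i, ContDiff ℝ 1 (f i) := fun i =>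
      (f i).contMDiff.contDiff.of_le (by exact_mod_cast le_top)
    have hfc : ∀ i, HasCompactSupport (f i) := fun i =>
      Metric.isCompact_of_isClosed_isBounded (isClosed_tsupport _) (isBounded_ball.subset (hf i))
    have hsum : ∀ x ∈ C, ∑ i, f i x = 1 := fun x hx => by
      rw [← finsum_eq_sum_of_fintype]; exact f.sum_eq_one hx
    have hfi : ∀ i, IntegrableOn (f i) (frontier Ω) μHE[k] := fun i =>
      (hfC i).continuous.integrable_of_hasCompactSupport (hfc i)
    have hdi : ∀ i, IntegrableOn (fun x => fderiv ℝ (f i) x w) Ω := fun i =>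
      ((((hfC i).continuous_fderiv one_ne_zero).clm_apply
        continuous_const).integrable_of_hasCompactSupport ((hfc i).fderiv_apply ℝ w)).integrableOn
    have hrank : 1 < Module.rank ℝ E := by
      rw [← finrank_eq_rank, hk]; exact_mod_cast (by omega)
    have hzero : ∑ i, ∫ x in Ω, fderiv ℝ (f i) x w = 0 := by
      rw [← integral_finsetSum _ fun i _ => hdi i]
      have h1 : ∀ x, ∑ i, fderiv ℝ (f i) x w = fderiv ℝ (fun x => ∑ i, f i x) x w := by
        intro x
        rw [fderiv_fun_sum fun i _ => (hfC i).differentiable one_ne_zero x]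
        simp
      simp_rw [h1]
      refine setIntegral_fderiv_eq_zero hrank volume hΩ hS (ContDiff.sum fun i _ => hfC i) ?_ ?_ w
      · have : IsCompact (⋃ i, tsupport (f i)) := isCompact_iUnion hfc
        refine HasCompactSupport.intro this fun x hx => ?_
        refine Finset.sum_eq_zero fun i _ => image_eq_zero_of_notMem_tsupport fun h => hx ?_
        exact mem_iUnion.2 ⟨i, h⟩
      · intro p hp
        filter_upwards [mem_interior_iff_mem_nhds.1 (hSC hp)] with x hx
        exact hsum x hx
    have hni := fun i => integrableOn_mul_inner_normal hSm hnc hn1 (hfi i) w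
    have h1 : ∫ x in frontier Ω, ⟪n x, w⟫ ∂μHE[k] =
        ∑ i, ∫ x in frontier Ω, f i x * ⟪n x, w⟫ ∂μHE[k] := by
      rw [← integral_finsetSum _ fun i _ => hni i]
      refine setIntegral_congr_fun hSm fun x hx => ?_
      rw [← Finset.sum_mul, hsum x (interior_subset (hSC hx)), one_mul]
    have h2 : ∑ i, ∫ x in frontier Ω, f i x ∂μHE[k] = μHE[k].real (frontier Ω) := by
      rw [← integral_finsetSum _ fun i _ => hfi i, setIntegral_congr_fun (g := fun _ => (1 : ℝ)) hSm
        fun x hx => hsum x (interior_subset (hSC hx))]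
      simp
    -- Each local error is `ε` times the mass of its bump, so the total is `ε` times the measure of
    -- the frontier, independently of the number of balls.
    calc |∫ x in frontier Ω, ⟪n x, w⟫ ∂μHE[k]|
        = |∑ i, ((∫ x in Ω, fderiv ℝ (f i) x w) -
            ∫ x in frontier Ω, f i x * ⟪n x, w⟫ ∂μHE[k])| := by
          rw [Finset.sum_sub_distrib, hzero, ← h1, zero_sub, abs_neg]
      _ ≤ ∑ i, ε * ∫ x in frontier Ω, f i x ∂μHE[k] := by
          refine (Finset.abs_sum_le_sum_abs _ _).trans (Finset.sum_le_sum fun i _ => ?_)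
          exact herr i (ht i i.2) (f i) (hfC i) (hf i) (f.nonneg i)
      _ = ε * μHE[k].real (frontier Ω) := by rw [← Finset.mul_sum, h2]
  rw [← abs_eq_zero]
  refine le_antisymm (le_of_forall_pos_le_add fun ε hε => ?_) (abs_nonneg _)
  have hm : 0 ≤ μHE[k].real (frontier Ω) := measureReal_nonneg
  refine (key (ε / (μHE[k].real (frontier Ω) + 1)) (by positivity)).trans ?_
  rw [zero_add, div_mul_eq_mul_div, div_le_iff₀ (by positivity)]
  nlinarith

end Divergence

/-! ### Unsigned normals, sides of a hypersurface, and the choice of sign -/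

section Normal

variable {E : Type*} [NormedAddCommGroup E] [InnerProductSpace ℝ E]

/-- Near `p`, the set `S` is the zero set of a function with gradient `n` at `p`. -/
def IsNormal (S : Set E) (n p : E) : Prop :=
  ∃ h : E → ℝ, HasStrictFDerivAt h (innerSL ℝ n) p ∧ ∀ᶠ x in 𝓝 p, x ∈ S ↔ h x = 0

theorem IsNormal.exists_ball {S : Set E} {n p : E} (h : IsNormal S n p) {η : ℝ} (hη : 0 < η) :
    ∃ g : E → ℝ, HasStrictFDerivAt g (innerSL ℝ n) p ∧ ∃ r > 0,
      (∀ x ∈ ball p r, x ∈ S ↔ g x = 0) ∧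
      ∀ x ∈ ball p r, ∀ y ∈ ball p r, |g x - g y - ⟪n, x - y⟫| ≤ η * ‖x - y‖ := by
  obtain ⟨g, hg, hev⟩ := h
  have h1 := hg.isLittleO.def hη
  rw [nhds_prod_eq, eventually_prod_self_iff'] at h1
  obtain ⟨t, ht, h2⟩ := h1
  obtain ⟨r, hr, hrt⟩ := Metric.mem_nhds_iff.1 (inter_mem ht hev)
  refine ⟨g, hg, r, hr, fun x hx => (hrt hx).2, fun x hx y hy => ?_⟩
  simpa using h2 x (hrt hx).1 y (hrt hy).1

/-- A hypersurface is locally connected. -/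
theorem IsNormal.exists_isPreconnected {S : Set E} {n p : E} (h : IsNormal S n p) (hn : ‖n‖ = 1)
    (hp : p ∈ S) : ∃ C ⊆ S, IsPreconnected C ∧ ∀ᶠ x in 𝓝 p, x ∈ S → x ∈ C := by
  obtain ⟨g, -, r, hr, hgS, hg⟩ := h.exists_ball (η := 1 / 2) (by norm_num)
  have hnn : ⟪n, n⟫ = 1 := by rw [real_inner_self_eq_norm_sq, hn]; norm_num
  have hp0 : g p = 0 := (hgS p (mem_ball_self hr)).1 hp
  obtain ⟨δ, hδ, hδr, hz⟩ := exists_zero_on_line hn hn (by rw [hnn]; exact one_pos) hr hp0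
    (by rwa [hnn])
  -- Sliding `z` along `n` to the zero set gives a map `z ↦ z + s z • n`, continuous because `s` is
  -- `3`-Lipschitz. It fixes the points of `S`, so the image of a small ball is a connected piece of
  -- `S` containing all its points near `p`.
  choose! s hs hs0 using hz
  have hest : ∀ z z' : E, ∀ a b : ℝ, z + a • n ∈ ball p r → z' + b • n ∈ ball p r →
      g (z + a • n) = 0 → g (z' + b • n) = 0 → |a - b| ≤ 3 * ‖z - z'‖ := by
    intro z z' a b h1 h2 h3 h4
    have h5 := hg _ h1 _ h2
    have h6 : z + a • n - (z' + b • n) = (z - z') + (a - b) • n := by rw [sub_smul]; abel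
    rw [h3, h4, sub_zero, zero_sub, abs_neg, h6, inner_add_right, inner_smul_right, hnn,
      mul_one] at h5
    have h7 : ‖(z - z') + (a - b) • n‖ ≤ ‖z - z'‖ + |a - b| := by
      refine (norm_add_le _ _).trans ?_
      rw [norm_smul, hn, mul_one, Real.norm_eq_abs]
    have h8 : |⟪n, z - z'⟫| ≤ ‖z - z'‖ := by simpa [hn] using abs_real_inner_le_norm n (z - z')
    have h9 : |a - b| ≤ |⟪n, z - z'⟫ + (a - b)| + |⟪n, z - z'⟫| := by
      calc |a - b| = |(⟪n, z - z'⟫ + (a - b)) - ⟪n, z - z'⟫| := by congr 1; ring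
        _ ≤ _ := abs_sub _ _
    linarith
  have hcont : ContinuousOn (fun z => z + s z • n) (ball p δ) := by
    have h1 : LipschitzOnWith 3 s (ball p δ) := by
      refine LipschitzOnWith.of_dist_le_mul fun z hz z' hz' => ?_
      rw [dist_eq_norm, dist_eq_norm]
      exact hest z z' _ _ (hs z hz) (hs z' hz') (hs0 z hz) (hs0 z' hz')
    exact continuousOn_id.add (h1.continuousOn.smul continuousOn_const)
  refine ⟨(fun z => z + s z • n) '' ball p δ, ?_, ?_, ?_⟩
  · rintro _ ⟨z, hz, rfl⟩
    exact (hgS _ (hs z hz)).2 (hs0 z hz)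
  · exact (convex_ball p δ).isPreconnected.image _ hcont
  · filter_upwards [ball_mem_nhds p hδ] with x hx hxS
    refine ⟨x, hx, ?_⟩
    have hxr : x ∈ ball p r := ball_subset_ball hδr.le hx
    have h1 := hest x x (s x) 0 (hs x hx) (by simpa using hxr) (hs0 x hx)
      (by simpa using (hgS x hxr).1 hxS)
    rw [sub_self, norm_zero, mul_zero, sub_zero] at h1
    have h2 : s x = 0 := abs_nonpos_iff.1 h1
    simp [h2]

theorem mem_iff_mem_of_segment_disjoint_frontier {Ω : Set E} {x y : E}
    (h : ∀ z ∈ segment ℝ x y, z ∉ frontier Ω) : x ∈ Ω ↔ y ∈ Ω := by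
  rcases subset_or_subset_compl_of_disjoint_frontier (convex_segment x y).isPreconnected
    (disjoint_left.2 h) with h1 | h1
  · exact iff_of_true (h1 (left_mem_segment ℝ x y)) (h1 (right_mem_segment ℝ x y))
  · exact iff_of_false (h1 (left_mem_segment ℝ x y)) (h1 (right_mem_segment ℝ x y))

/-- The part `{g < 0}` of a small ball around `p` is either contained in `Ω` or disjoint from
it. -/
theorem mem_iff_of_neg {Ω : Set E} {n p : E} {r : ℝ} (hr : 0 < r) (hn : ‖n‖ = 1) {g : E → ℝ}
    (hp : g p = 0) (hgS : ∀ x ∈ ball p r, x ∈ frontier Ω ↔ g x = 0)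
    (hg : ∀ x ∈ ball p r, ∀ y ∈ ball p r, |g x - g y - ⟪n, x - y⟫| ≤ 1 / 4 * ‖x - y‖) {x : E}
    (hx : x ∈ ball p (r / 16)) (hgx : g x < 0) : x ∈ Ω ↔ p - (r / 2) • n ∈ Ω := by
  have hnn : ⟪n, n⟫ = 1 := by rw [real_inner_self_eq_norm_sq, hn]; norm_num
  rw [mem_ball, dist_eq_norm] at hx
  have hmem : ∀ y : E, ∀ τ : ℝ, ‖y - p‖ < r / 16 → 0 ≤ τ → τ ≤ r / 2 → y - τ • n ∈ ball p r := by
    intro y τ hy h0 h1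
    rw [mem_ball, dist_eq_norm]
    calc ‖y - τ • n - p‖ = ‖(y - p) - τ • n‖ := by congr 1; abel
      _ ≤ ‖y - p‖ + ‖τ • n‖ := norm_sub_le _ _
      _ < r := by rw [norm_smul, hn, mul_one, Real.norm_eq_abs, abs_of_nonneg h0]; linarith
  have hxr : x ∈ ball p r := by simpa using hmem x 0 hx le_rfl (by linarith)
  -- Join `x` to the base point by a descent along `n` and then a sideways move. As `x` is within `r
  -- / 16` of `p`, `g` stays negative on both segments, so neither crosses the frontier.
  have hstep₁ : x ∈ Ω ↔ x - (r / 2) • n ∈ Ω := by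
    refine mem_iff_mem_of_segment_disjoint_frontier fun z hz => ?_
    rw [segment_eq_image'] at hz
    obtain ⟨θ, hθ, rfl⟩ := hz
    have h1 : x + θ • (x - (r / 2) • n - x) = x - (θ * (r / 2)) • n := by
      rw [sub_sub_cancel_left, smul_neg, smul_smul]; abel
    have hτ0 : 0 ≤ θ * (r / 2) := mul_nonneg hθ.1 (by positivity)
    have hτ1 : θ * (r / 2) ≤ r / 2 := mul_le_of_le_one_left (by positivity) hθ.2
    dsimp only
    rw [h1]
    have hm := hmem x _ hx hτ0 hτ1
    have h2 := (abs_le.1 (hg _ hm x hxr)).2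
    rw [sub_sub_cancel_left, inner_neg_right, inner_smul_right, hnn, norm_neg, norm_smul, hn,
      Real.norm_eq_abs, abs_of_nonneg hτ0] at h2
    exact fun h3 => ((hgS _ hm).1 h3).not_lt (by linarith)
  have hstep₂ : x - (r / 2) • n ∈ Ω ↔ p - (r / 2) • n ∈ Ω := by
    refine mem_iff_mem_of_segment_disjoint_frontier fun z hz => ?_
    rw [segment_eq_image'] at hz
    obtain ⟨θ, hθ, rfl⟩ := hz
    have h1 : x - (r / 2) • n + θ • (p - (r / 2) • n - (x - (r / 2) • n)) =
        (x + θ • (p - x)) - (r / 2) • n := by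
      rw [sub_sub_sub_cancel_right]; abel
    have h2 : ‖x + θ • (p - x) - p‖ < r / 16 := by
      have : x + θ • (p - x) - p = (1 - θ) • (x - p) := by
        rw [sub_smul, one_smul, smul_sub, smul_sub]; abel
      rw [this, norm_smul, Real.norm_eq_abs, abs_of_nonneg (by linarith [hθ.2])]
      exact (mul_le_of_le_one_left (norm_nonneg _) (by linarith [hθ.1])).trans_lt hx
    dsimp only
    rw [h1]
    set y := x + θ • (p - x)
    have hm := hmem y (r / 2) h2 (by positivity) le_rfl
    have h3 := (abs_le.1 (hg _ hm p (mem_ball_self hr))).2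
    have h4 : y - (r / 2) • n - p = (y - p) - (r / 2) • n := by abel
    have h5 : ‖(y - p) - (r / 2) • n‖ ≤ ‖y - p‖ + r / 2 := by
      refine (norm_sub_le _ _).trans ?_
      rw [norm_smul, hn, Real.norm_eq_abs, abs_of_pos (by positivity), mul_one]
    have h6 := (abs_le.1 (abs_real_inner_le_norm n (y - p))).2
    rw [hn, one_mul] at h6
    rw [h4, inner_sub_right, inner_smul_right, hnn, hp] at h3
    exact fun h7 => ((hgS _ hm).1 h7).not_lt (by linarith)
  exact hstep₁.trans hstep₂

/-- Each side `{g < 0}`, `{g > 0}` near `p` lies in `Ω` or misses it. Both inside would put `p` in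
the interior of `closure Ω`, against `hcl`; both outside would put `p` off `closure Ω`. So exactly
one side is inside. -/
theorem IsNormal.isOuterNormal_or {Ω : Set E} (hΩ : IsOpen Ω)
    (hcl : frontier (closure Ω) = frontier Ω) {n p : E} (h : IsNormal (frontier Ω) n p)
    (hn : ‖n‖ = 1) (hp : p ∈ frontier Ω) : IsOuterNormal Ω n p ∨ IsOuterNormal Ω (-n) p := by
  obtain ⟨g, hgd, r, hr, hgS, hg⟩ := h.exists_ball (η := 1 / 4) (by norm_num)
  have hp0 : g p = 0 := (hgS p (mem_ball_self hr)).1 hp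
  have hneg := fun x (hx : x ∈ ball p (r / 16)) => mem_iff_of_neg hr hn hp0 hgS hg hx
  have hpos : ∀ x ∈ ball p (r / 16), 0 < g x → (x ∈ Ω ↔ p + (r / 2) • n ∈ Ω) := by
    intro x hx hgx
    have h1 := mem_iff_of_neg (Ω := Ω) (n := -n) (g := fun y => -g y) hr (by rwa [norm_neg])
      (by simpa using hp0) (fun y hy => by rw [neg_eq_zero]; exact hgS y hy)
      (fun y hy z hz => by
        have h2 := hg y hy z hz
        rw [← abs_neg] at h2
        convert h2 using 2
        rw [inner_neg_left]; ring) hx (by simpa using hgx)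
    rwa [smul_neg, sub_neg_eq_add] at h1
  have hball : ball p (r / 16) ∈ 𝓝 p := ball_mem_nhds p (by positivity)
  have hsub : ball p (r / 16) ⊆ ball p r := ball_subset_ball (by linarith)
  have hfr : ∀ x ∈ frontier Ω, x ∉ Ω := fun x hx hxΩ => by
    rw [hΩ.frontier_eq] at hx; exact hx.2 hxΩ
  by_cases hm : p - (r / 2) • n ∈ Ω <;> by_cases hpl : p + (r / 2) • n ∈ Ω
  · exfalso
    have h1 : ball p (r / 16) ⊆ closure Ω := by
      intro x hx
      rcases lt_trichotomy (g x) 0 with h2 | h2 | h2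
      · exact subset_closure ((hneg x hx h2).2 hm)
      · exact frontier_subset_closure ((hgS x (hsub hx)).2 h2)
      · exact subset_closure ((hpos x hx h2).2 hpl)
    rw [← hcl] at hp
    exact hp.2 (mem_interior_iff_mem_nhds.2 (mem_of_superset hball h1))
  · left
    refine ⟨g, hgd, ?_⟩
    filter_upwards [hball] with x hx
    refine ⟨hgS x (hsub hx), ?_⟩
    rcases lt_trichotomy (g x) 0 with h2 | h2 | h2
    · exact iff_of_true ((hneg x hx h2).2 hm) h2
    · exact iff_of_false (hfr x ((hgS x (hsub hx)).2 h2)) (by rw [h2]; exact lt_irrefl _)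
    · exact iff_of_false (fun h3 => hpl ((hpos x hx h2).1 h3)) h2.not_gt
  · right
    refine ⟨fun x => -g x, by simpa using hgd.fun_neg, ?_⟩
    filter_upwards [hball] with x hx
    rw [neg_eq_zero, neg_lt_zero]
    refine ⟨hgS x (hsub hx), ?_⟩
    rcases lt_trichotomy (g x) 0 with h2 | h2 | h2
    · exact iff_of_false (fun h3 => hm ((hneg x hx h2).1 h3)) h2.not_gt
    · exact iff_of_false (hfr x ((hgS x (hsub hx)).2 h2)) (by rw [h2]; exact lt_irrefl _)
    · exact iff_of_true ((hpos x hx h2).2 hpl) h2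
  · exfalso
    obtain ⟨x, hx, hxΩ⟩ := mem_closure_iff_nhds.1 (frontier_subset_closure hp) _ hball
    rcases lt_trichotomy (g x) 0 with h2 | h2 | h2
    · exact hm ((hneg x hx h2).1 hxΩ)
    · exact hfr x ((hgS x (hsub hx)).2 h2) hxΩ
    · exact hpl ((hpos x hx h2).1 hxΩ)

/-- Opposite vectors are not both outer normals, even at nearby points. -/
theorem IsOuterNormal.eventually_not_neg {Ω : Set E} {n p : E} (h : IsOuterNormal Ω n p) :
    ∀ᶠ q in 𝓝 p, ∀ m : E, ‖m‖ = 1 → 1 / 2 < ⟪n, m⟫ → q ∈ frontier Ω →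
      ¬ IsOuterNormal Ω (-m) q := by
  obtain ⟨g, r, hr, hg, hgd⟩ := h.exists_ball (η := 1 / 4) (by norm_num)
  filter_upwards [ball_mem_nhds p hr] with q hqr m hm hq hqS hcon
  obtain ⟨g', r', hr', hg', hgd'⟩ := hcon.exists_ball (η := 1 / 4) (by norm_num)
  -- A short step from `q` along `m` would enter `Ω` if `-m` were an outer normal there, but it
  -- raises `g`, because `⟪n, m⟫ > 1 / 2` exceeds the error constant `1 / 4`.
  have h3 : Tendsto (fun s : ℝ => q + s • m) (𝓝[>] 0) (𝓝 q) := by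
    have h4 : Continuous (fun s : ℝ => q + s • m) := by fun_prop
    have h5 := h4.tendsto 0
    rw [zero_smul, add_zero] at h5
    exact h5.mono_left nhdsWithin_le_nhds
  obtain ⟨s, ⟨hs1, hs2⟩, hs0⟩ := ((h3.eventually (inter_mem (isOpen_ball.mem_nhds hqr)
    (ball_mem_nhds q hr'))).and self_mem_nhdsWithin).exists
  have hs0 : 0 < s := hs0
  have k1 := (abs_le.1 (hgd _ hs1 q hqr)).1
  have k2 := (abs_le.1 (hgd' _ hs2 q (mem_ball_self hr'))).2
  rw [add_sub_cancel_left, norm_smul, hm, inner_smul_right, Real.norm_eq_abs,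
    abs_of_pos hs0] at k1 k2
  rw [((hg q hqr).1).1 hqS] at k1
  rw [((hg' q (mem_ball_self hr')).1).1 hqS, inner_neg_left, real_inner_self_eq_norm_sq, hm] at k2
  have k3 : q + s • m ∈ Ω := ((hg' _ hs2).2).2 (by linarith)
  have k4 := ((hg _ hs1).2).1 k3
  nlinarith

/-- Being the outer normal is a locally constant property of a continuous unit normal field. -/
theorem IsOuterNormal.eventually {Ω : Set E} {N : E → E} {p : E}
    (hNc : ContinuousWithinAt N (frontier Ω) p) (hp : p ∈ frontier Ω)
    (hN1 : ∀ q ∈ frontier Ω, ‖N q‖ = 1) (h : IsOuterNormal Ω (N p) p)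
    (hor : ∀ q ∈ frontier Ω, IsOuterNormal Ω (N q) q ∨ IsOuterNormal Ω (-N q) q) :
    ∀ᶠ q in 𝓝[frontier Ω] p, IsOuterNormal Ω (N q) q := by
  have h1 : ∀ᶠ q in 𝓝[frontier Ω] p, 1 / 2 < ⟪N p, N q⟫ := by
    have h2 : ContinuousWithinAt (fun q => ⟪N p, N q⟫) (frontier Ω) p :=
      ContinuousWithinAt.inner continuousWithinAt_const hNc
    refine h2.eventually (lt_mem_nhds ?_)
    change 1 / 2 < ⟪N p, N p⟫
    rw [real_inner_self_eq_norm_sq, hN1 p hp]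
    norm_num
  filter_upwards [h1, self_mem_nhdsWithin, nhdsWithin_le_nhds h.eventually_not_neg]
    with q hq hqS hqn
  exact (hor q hqS).resolve_right (hqn (N q) (hN1 q hqS) hq hqS)

/-- The points where `N` is outer and those where `-N` is outer form two disjoint open sets covering
the connected frontier. -/
theorem exists_sign_isOuterNormal {Ω : Set E} (hconn : IsPreconnected (frontier Ω)) {N : E → E}
    (hNc : ContinuousOn N (frontier Ω)) (hN1 : ∀ q ∈ frontier Ω, ‖N q‖ = 1)
    (hor : ∀ q ∈ frontier Ω, IsOuterNormal Ω (N q) q ∨ IsOuterNormal Ω (-N q) q) :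
    (∀ q ∈ frontier Ω, IsOuterNormal Ω (N q) q) ∨ ∀ q ∈ frontier Ω, IsOuterNormal Ω (-N q) q := by
  have hopen : ∀ N' : E → E, ContinuousOn N' (frontier Ω) → (∀ q ∈ frontier Ω, ‖N' q‖ = 1) →
      (∀ q ∈ frontier Ω, IsOuterNormal Ω (N' q) q ∨ IsOuterNormal Ω (-N' q) q) →
      IsOpen {q : frontier Ω | IsOuterNormal Ω (N' q) q} := by
    intro N' h1 h2 h3
    refine isOpen_iff_mem_nhds.2 fun p hp => ?_
    have h4 := IsOuterNormal.eventually (h1 p p.2) p.2 h2 hp h3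
    exact preimage_coe_mem_nhds_subtype.2 h4
  have ho₁ := hopen N hNc hN1 hor
  have ho₂ := hopen (fun q => -N q) hNc.neg (fun q hq => by rw [norm_neg]; exact hN1 q hq)
    (fun q hq => by rw [neg_neg]; exact (hor q hq).symm)
  have hex : ∀ q ∈ frontier Ω, IsOuterNormal Ω (N q) q → ¬ IsOuterNormal Ω (-N q) q := by
    intro q hq h1
    refine h1.eventually_not_neg.self_of_nhds (N q) (hN1 q hq) ?_ hq
    rw [real_inner_self_eq_norm_sq, hN1 q hq]
    norm_num
  have : PreconnectedSpace (frontier Ω) := isPreconnected_iff_preconnectedSpace.1 hconn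
  have hcompl : {q : frontier Ω | IsOuterNormal Ω (N q) q}ᶜ =
      {q : frontier Ω | IsOuterNormal Ω (-N q) q} := by
    ext q
    exact ⟨fun h => (hor q q.2).resolve_left h, fun h h' => hex q q.2 h' h⟩
  rcases isClopen_iff.1 (⟨⟨hcompl ▸ ho₂⟩, ho₁⟩ :
    IsClopen {q : frontier Ω | IsOuterNormal Ω (N q) q}) with h | h
  · right
    rw [h, compl_empty] at hcompl
    exact fun q hq => (hcompl ▸ mem_univ (⟨q, hq⟩ : frontier Ω) :)
  · left
    exact fun q hq => (h ▸ mem_univ (⟨q, hq⟩ : frontier Ω) :)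

variable [FiniteDimensional ℝ E] [MeasurableSpace E] [BorelSpace E]

/-- The integral of a continuous unit normal field over a compact connected hypersurface which
bounds an open set on one side is zero. -/
theorem integral_inner_normal_eq_zero {k : ℕ} (hk : finrank ℝ E = k + 1) (hk1 : 1 ≤ k)
    {Ω : Set E} (hΩ : IsOpen Ω) (hcl : frontier (closure Ω) = frontier Ω)
    (hS : IsCompact (frontier Ω)) (hconn : IsConnected (frontier Ω)) {N : E → E}
    (hNc : ContinuousOn N (frontier Ω)) (hN1 : ∀ q ∈ frontier Ω, ‖N q‖ = 1)
    (hN : ∀ q ∈ frontier Ω, IsNormal (frontier Ω) (N q) q) :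
    μHE[k] (frontier Ω) < ⊤ ∧ μHE[k] (frontier Ω) ≠ 0 ∧
      ∀ w : E, ‖w‖ ≤ 1 → ∫ x in frontier Ω, ⟪N x, w⟫ ∂μHE[k] = 0 := by
  have main : ∀ n : E → E, ContinuousOn n (frontier Ω) → (∀ q ∈ frontier Ω, ‖n q‖ = 1) →
      (∀ q ∈ frontier Ω, IsOuterNormal Ω (n q) q) →
      μHE[k] (frontier Ω) < ⊤ ∧ μHE[k] (frontier Ω) ≠ 0 ∧
        ∀ w : E, ‖w‖ ≤ 1 → ∫ x in frontier Ω, ⟪n x, w⟫ ∂μHE[k] = 0 := by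
    intro n h1 h2 h3
    obtain ⟨p, hp⟩ := hconn.nonempty
    refine ⟨euclideanHausdorffMeasure_frontier_lt_top hk hΩ.measurableSet hS h2 h3,
      (exists_ball_integral_comparison hk hΩ.measurableSet hp (h2 p hp) (h3 p hp) (h2 p hp)
        (by rw [real_inner_self_eq_norm_sq, h2 p hp]; norm_num) one_lt_two).1, fun w hw => ?_⟩
    exact integral_inner_outerNormal_eq_zero hk hk1 hΩ.measurableSet hS h1 h2 h3 hw
  rcases exists_sign_isOuterNormal hconn.isPreconnected hNc hN1
    (fun q hq => (hN q hq).isOuterNormal_or hΩ hcl (hN1 q hq) hq) with h | h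
  · exact main N hNc hN1 h
  · obtain ⟨h1, h2, h3⟩ := main (fun q => -N q) hNc.neg
      (fun q hq => by rw [norm_neg]; exact hN1 q hq) h
    refine ⟨h1, h2, fun w hw => ?_⟩
    have h4 := h3 w hw
    simp_rw [inner_neg_left] at h4
    rwa [integral_neg, neg_eq_zero] at h4

end Normal

/-! ### Geometry of the hypersurface and its cross-sections -/

section Hypersurface

variable {d : ℕ} {M U V : Set (Space d)} {f g : Space d → ℝ} {p : Space d}

theorem IsDefiningFunction.hasStrictFDerivAt (hf : IsDefiningFunction M U f) (hp : p ∈ U) :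
    HasStrictFDerivAt f (fderiv ℝ f p) p :=
  (hf.smooth.contDiffAt (hf.isOpen.mem_nhds hp)).hasStrictFDerivAt (by simp)

theorem IsDefiningFunction.mem_iff (hf : IsDefiningFunction M U f) (hp : p ∈ U) :
    p ∈ M ↔ f p = 0 := by
  have h1 : p ∈ M ∩ U ↔ p ∈ {x ∈ U | f x = 0} := by rw [hf.zeroSet]
  exact ⟨fun h => (h1.1 ⟨h, hp⟩).2, fun h => (h1.2 ⟨hp, h⟩).1⟩

/-- Two local defining functions of a hypersurface have differentials with the same kernel. -/
theorem IsDefiningFunction.fderiv_apply_eq_zero (hf : IsDefiningFunction M U f)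
    (hg : IsDefiningFunction M V g) (hpM : p ∈ M) (hpU : p ∈ U) (hpV : p ∈ V) {v : Space d}
    (hv : fderiv ℝ f p v = 0) : fderiv ℝ g p v = 0 := by
  have hfp := (hf.mem_iff hpU).1 hpM
  have hgp := (hg.mem_iff hpV).1 hpM
  -- `g` vanishes on the zero set of `f`, a trivial constrained extremum, so Lagrange multipliers
  -- make the two differentials dependent; regularity of `f` excludes a zero coefficient at `g`.
  have hext : IsLocalExtrOn g {x | f x = f p} p := by
    left
    filter_upwards [self_mem_nhdsWithin, mem_nhdsWithin_of_mem_nhds (hf.isOpen.mem_nhds hpU),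
      mem_nhdsWithin_of_mem_nhds (hg.isOpen.mem_nhds hpV)] with x hx hxU hxV
    have hx : f x = f p := hx
    rw [hgp, (hg.mem_iff hxV).1 ((hf.mem_iff hxU).2 (hx.trans hfp))]
  obtain ⟨a, b, hab, h⟩ := hext.exists_multipliers_of_hasStrictFDerivAt_1d
    (hf.hasStrictFDerivAt hpU) (hg.hasStrictFDerivAt hpV)
  by_cases hb : b = 0
  · have ha : a ≠ 0 := fun ha => hab (by rw [ha, hb]; rfl)
    rw [hb, zero_smul, add_zero, smul_eq_zero_iff_right ha] at h
    exact absurd (by rw [gradient, h, map_zero]) (hf.regular p hpU)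
  · have h1 := congrArg (fun L : Space d →L[ℝ] ℝ => L v) h
    simpa [hv, hb] using h1

theorem IsDefiningFunction.tangentSpace_eq (hf : IsDefiningFunction M U f) (hpM : p ∈ M)
    (hpU : p ∈ U) : tangentSpace M p = (ℝ ∙ ∇ f p)ᗮ := by
  ext v
  rw [Submodule.mem_orthogonal_singleton_iff_inner_right, inner_gradient_left]
  exact ⟨fun h => h U f hpU hf, fun h V g hpV hg => hf.fderiv_apply_eq_zero hg hpM hpU hpV h⟩

theorem IsGaussMap.exists_eq_smul_gradient {γ : Space d → Space d} (hγ : IsGaussMap M γ)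
    (hf : IsDefiningFunction M U f) (hpM : p ∈ M) (hpU : p ∈ U) :
    ∃ a : ℝ, a ≠ 0 ∧ γ p = a • ∇ f p := by
  have h := hγ.normal p hpM
  rw [hf.tangentSpace_eq hpM hpU, Submodule.orthogonal_orthogonal,
    Submodule.mem_span_singleton] at h
  obtain ⟨a, ha⟩ := h
  refine ⟨a, ?_, ha.symm⟩
  rintro rfl
  have h1 := hγ.norm_eq_one p hpM
  rw [← ha, zero_smul, norm_zero] at h1
  exact zero_ne_one h1

theorem IsGaussMap.tangentSpace_eq {γ : Space d → Space d} (hγ : IsGaussMap M γ)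
    (hM : IsEmbeddedHypersurface M) (hpM : p ∈ M) : tangentSpace M p = (ℝ ∙ γ p)ᗮ := by
  obtain ⟨U, f, hpU, hf⟩ := hM p hpM
  obtain ⟨a, ha, h⟩ := hγ.exists_eq_smul_gradient hf hpM hpU
  rw [hf.tangentSpace_eq hpM hpU, h, Submodule.span_singleton_smul_eq (IsUnit.mk0 a ha)]

theorem norm_axis (d : ℕ) : ‖axis d‖ = 1 := by simp [axis]

theorem inner_axis (x : Space d) : ⟪axis d, x⟫ = x (Fin.last d) := by
  simp [axis, EuclideanSpace.inner_single_left]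

theorem starProjection_axis {γ : Space d → Space d} (hγ : IsGaussMap M γ)
    (hM : IsEmbeddedHypersurface M) (hpM : p ∈ M) :
    (tangentSpace M p).starProjection (axis d) = axis d - ⟪axis d, γ p⟫ • γ p := by
  rw [hγ.tangentSpace_eq hM hpM, Submodule.starProjection_orthogonal_val,
    Submodule.starProjection_unit_singleton ℝ (hγ.norm_eq_one p hpM), real_inner_comm]

/-- A vertical `γ p` would make the tangent space horizontal, contradicting regularity of `t`. -/
theorem norm_perpProj_axis_pos {γ : Space d → Space d} (hγ : IsGaussMap M γ)
    (hM : IsEmbeddedHypersurface M) {t : ℝ} (hreg : IsRegularValue M t)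
    (hp : p ∈ crossSection M t) : 0 < ‖perpProj (axis d) (γ p)‖ := by
  rw [norm_pos_iff]
  intro h0
  obtain ⟨v, hv, hv0⟩ := hreg p hp
  have h1 := coe_perpProj (norm_axis d) (γ p)
  rw [h0, Submodule.coe_zero] at h1
  have h2 : γ p = ⟪axis d, γ p⟫ • axis d := (sub_eq_zero.1 h1.symm)
  have h3 : ⟪γ p, v⟫ = 0 := by
    rw [hγ.tangentSpace_eq hM hp.1] at hv
    exact Submodule.mem_orthogonal_singleton_iff_inner_right.1 hv
  rw [h2, inner_smul_left, inner_axis v] at h3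
  have h4 : ⟪axis d, γ p⟫ = 0 := by simpa [hv0] using h3
  rw [h4, zero_smul] at h2
  have h5 := hγ.norm_eq_one p hp.1
  rw [h2, norm_zero] at h5
  exact zero_ne_one h5

theorem norm_perpProj_axis {γ : Space d → Space d} (hγ : IsGaussMap M γ) (hpM : p ∈ M) :
    ‖perpProj (axis d) (γ p)‖ = √(1 - ⟪axis d, γ p⟫ ^ 2) := by
  have h := norm_sq_perpProj (norm_axis d) (γ p)
  rw [hγ.norm_eq_one p hpM, one_pow] at h
  rw [← h, Real.sqrt_sq (norm_nonneg _)]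

/-- For two unit vectors, each has the same distance to the line spanned by the other, so the
normalizing factor is the length of the horizontal part of `γ p`. -/
theorem conormal_eq {γ : Space d → Space d} (hγ : IsGaussMap M γ)
    (hM : IsEmbeddedHypersurface M) (hpM : p ∈ M) :
    conormal M p = ‖perpProj (axis d) (γ p)‖⁻¹ • (axis d - ⟪axis d, γ p⟫ • γ p) := by
  have h : ‖axis d - ⟪axis d, γ p⟫ • γ p‖ = ‖perpProj (axis d) (γ p)‖ := by
    rw [← sq_eq_sq₀ (norm_nonneg _) (norm_nonneg _), norm_sq_perpProj (norm_axis d),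
      norm_sub_sq_real, norm_smul, norm_axis, hγ.norm_eq_one p hpM, inner_smul_right,
      Real.norm_eq_abs, mul_one, sq_abs]
    ring
  rw [conormal, starProjection_axis hγ hM hpM, h]

/-- The affine isometry from the horizontal directions onto the hyperplane `Π_t`. -/
noncomputable def lift (d : ℕ) (t : ℝ) (y : (ℝ ∙ axis d)ᗮ) : Space d := y + t • axis d

theorem isometry_lift (d : ℕ) (t : ℝ) : Isometry (lift d t) :=
  Isometry.of_dist_eq fun x y => by simp [lift, Subtype.dist_eq]

theorem lift_mem_hyperplane (t : ℝ) (y : (ℝ ∙ axis d)ᗮ) : lift d t y ∈ hyperplane d t := by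
  have h1 : ⟪axis d, (y : Space d)⟫ = 0 :=
    Submodule.mem_orthogonal_singleton_iff_inner_right.1 y.2
  change lift d t y (Fin.last d) = t
  rw [← inner_axis, lift, inner_add_right, h1, inner_smul_right, real_inner_self_eq_norm_sq,
    norm_axis]
  simp

theorem lift_perpProj {t : ℝ} {x : Space d} (hx : x ∈ hyperplane d t) :
    lift d t (perpProj (axis d) x) = x := by
  have hx : x (Fin.last d) = t := hx
  rw [lift, coe_perpProj (norm_axis d), inner_axis, hx, sub_add_cancel]

/-- The affine isometry `lift`, as a homeomorphism onto the hyperplane `Π_t`. -/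
noncomputable def liftHomeomorph (d : ℕ) (t : ℝ) : (ℝ ∙ axis d)ᗮ ≃ₜ hyperplane d t where
  toFun y := ⟨lift d t y, lift_mem_hyperplane t y⟩
  invFun x := perpProj (axis d) x
  left_inv y := by
    apply (isometry_lift d t).injective
    exact lift_perpProj (lift_mem_hyperplane t y)
  right_inv x := Subtype.ext (lift_perpProj x.2)
  continuous_toFun := (isometry_lift d t).continuous.subtype_mk _
  continuous_invFun := (perpProj (axis d)).continuous.comp continuous_subtype_val

theorem inner_perpProj_left {E : Type*} [NormedAddCommGroup E] [InnerProductSpace ℝ E] {e : E}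
    (he : ‖e‖ = 1) (x : E) (y : (ℝ ∙ e)ᗮ) : ⟪perpProj e x, y⟫ = ⟪x, (y : E)⟫ := by
  have h1 : ⟪e, (y : E)⟫ = 0 := Submodule.mem_orthogonal_singleton_iff_inner_right.1 y.2
  rw [Submodule.coe_inner, coe_perpProj he, inner_sub_left, inner_smul_left, h1, mul_zero, sub_zero]

/-- The horizontal unit normal field of the cross-section, the normalized horizontal part of the
Gauss map. -/
noncomputable def sectionNormal (γ : Space d → Space d) (t : ℝ) (y : (ℝ ∙ axis d)ᗮ) :
    (ℝ ∙ axis d)ᗮ :=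
  ‖perpProj (axis d) (γ (lift d t y))‖⁻¹ • perpProj (axis d) (γ (lift d t y))

theorem norm_sectionNormal {γ : Space d → Space d} (hγ : IsGaussMap M γ)
    (hM : IsEmbeddedHypersurface M) {t : ℝ} (hreg : IsRegularValue M t) {y : (ℝ ∙ axis d)ᗮ}
    (hy : lift d t y ∈ crossSection M t) : ‖sectionNormal γ t y‖ = 1 := by
  rw [sectionNormal, norm_smul, norm_inv, norm_norm,
    inv_mul_cancel₀ (norm_perpProj_axis_pos hγ hM hreg hy).ne']

theorem continuousOn_sectionNormal {γ : Space d → Space d} (hγ : IsGaussMap M γ)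
    (hM : IsEmbeddedHypersurface M) {t : ℝ} (hreg : IsRegularValue M t) :
    ContinuousOn (sectionNormal γ t) (lift d t ⁻¹' crossSection M t) := by
  have h1 : ContinuousOn (fun y => perpProj (axis d) (γ (lift d t y)))
      (lift d t ⁻¹' crossSection M t) :=
    (perpProj (axis d)).continuous.comp_continuousOn
      (hγ.continuousOn.comp (isometry_lift d t).continuous.continuousOn fun y hy => hy.1)
  exact (h1.norm.inv₀ fun y hy => (norm_perpProj_axis_pos hγ hM hreg hy).ne').smul h1

/-- A local defining function of `M`, restricted to the hyperplane and rescaled by a nonzero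
constant, has the unit vector `sectionNormal γ t y` as its gradient at `y`. -/
theorem isNormal_crossSection {γ : Space d → Space d} (hγ : IsGaussMap M γ)
    (hM : IsEmbeddedHypersurface M) {t : ℝ} {y : (ℝ ∙ axis d)ᗮ} (hreg : IsRegularValue M t)
    (hy : lift d t y ∈ crossSection M t) :
    IsNormal (lift d t ⁻¹' crossSection M t) (sectionNormal γ t y) y := by
  obtain ⟨U, f, hpU, hf⟩ := hM _ hy.1
  obtain ⟨a, ha, hγf⟩ := hγ.exists_eq_smul_gradient hf hy.1 hpU
  have hpos := norm_perpProj_axis_pos hγ hM hreg hy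
  set c := ‖perpProj (axis d) (γ (lift d t y))‖⁻¹ * a with hc
  have hc0 : c ≠ 0 := mul_ne_zero (inv_ne_zero hpos.ne') ha
  refine ⟨fun z => c * f (lift d t z), ?_, ?_⟩
  · have h1 : HasStrictFDerivAt (lift d t) ((ℝ ∙ axis d)ᗮ).subtypeL y :=
      (((ℝ ∙ axis d)ᗮ).subtypeL.hasStrictFDerivAt).add_const _
    have h2 : innerSL ℝ (sectionNormal γ t y) =
        c • (fderiv ℝ f (lift d t y)).comp ((ℝ ∙ axis d)ᗮ).subtypeL := by
      ext z
      have h3 : ⟪γ (lift d t y), (z : Space d)⟫ = a * fderiv ℝ f (lift d t y) z := by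
        rw [hγf, real_inner_smul_left, inner_gradient_left]
      change ⟪sectionNormal γ t y, z⟫ = c * fderiv ℝ f (lift d t y) z
      rw [sectionNormal, real_inner_smul_left, inner_perpProj_left (norm_axis d), h3, hc, mul_assoc]
    rw [h2]
    exact ((hf.hasStrictFDerivAt hpU).comp y h1).const_mul c
  · filter_upwards [(isometry_lift d t).continuous.continuousAt.eventually
      (hf.isOpen.mem_nhds hpU)] with z hz
    have hz : lift d t z ∈ U := hz
    rw [mul_eq_zero, or_iff_right hc0, ← hf.mem_iff hz]
    exact ⟨fun h => h.1, fun h => ⟨h, lift_mem_hyperplane t z⟩⟩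

theorem IsCycle.subset {t : ℝ} {S : Set (Space d)} (hS : IsCycle M t S) : S ⊆ crossSection M t := by
  obtain ⟨P, -, -, -, rfl⟩ := hS.components
  exact iUnion₂_subset fun p _ => connectedComponentIn_subset _ _

theorem IsCycle.subset_of_isPreconnected {t : ℝ} {S C : Set (Space d)} (hS : IsCycle M t S)
    (hC : IsPreconnected C) (hCM : C ⊆ crossSection M t) (hpC : p ∈ C) (hpS : p ∈ S) : C ⊆ S := by
  obtain ⟨P, -, -, -, rfl⟩ := hS.components
  obtain ⟨q, hq, hpq⟩ := mem_iUnion₂.1 hpS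
  have h1 := hC.subset_connectedComponentIn hpC hCM
  rw [← connectedComponentIn_eq hpq] at h1
  exact h1.trans (subset_iUnion₂_of_subset q hq subset_rfl)

theorem IsCycle.isCompact {t : ℝ} {S : Set (Space d)} (hS : IsCycle M t S)
    (hc : IsCompact (crossSection M t)) : IsCompact S := by
  obtain ⟨P, hfin, -, hP, rfl⟩ := hS.components
  refine hfin.isCompact_biUnion fun p hp => ?_
  refine hc.of_isClosed_subset ?_ (connectedComponentIn_subset _ _)
  refine isClosed_of_closure_subset ?_
  refine (isPreconnected_connectedComponentIn.closure).subset_connectedComponentIn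
    (subset_closure (mem_connectedComponentIn (hP hp))) ?_
  exact closure_minimal (connectedComponentIn_subset _ _) hc.isClosed

/-- The section is locally connected, so its components are open in it and the cycle agrees with the
whole section near each of its points. -/
theorem isNormal_cycle {γ : Space d → Space d} (hγ : IsGaussMap M γ)
    (hM : IsEmbeddedHypersurface M) {t : ℝ} {S : Set (Space d)} (hS : IsCycle M t S)
    {y : (ℝ ∙ axis d)ᗮ} (hy : lift d t y ∈ S) :
    IsNormal (lift d t ⁻¹' S) (sectionNormal γ t y) y := by
  have hyM := hS.subset hy
  have hn := isNormal_crossSection hγ hM hS.regular hyM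
  obtain ⟨C, hCS, hC, hev⟩ :=
    hn.exists_isPreconnected (norm_sectionNormal hγ hM hS.regular hyM) hyM
  have hsub : lift d t '' C ⊆ S := hS.subset_of_isPreconnected
    (hC.image _ (isometry_lift d t).continuous.continuousOn) (image_subset_iff.2 hCS)
    (mem_image_of_mem _ (hev.self_of_nhds hyM)) hy
  obtain ⟨h, hd, hz⟩ := hn
  refine ⟨h, hd, ?_⟩
  filter_upwards [hz, hev] with z hz hev
  rw [← hz]
  exact ⟨fun h => hS.subset h, fun h => hsub (mem_image_of_mem _ (hev h))⟩

/-- The integral of the horizontal unit normal over a simple cycle is zero. -/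
theorem integral_inner_sectionNormal_eq_zero (hd : 2 ≤ d) {γ : Space d → Space d}
    (hγ : IsGaussMap M γ) (hM : IsEmbeddedHypersurface M) {t : ℝ} {S : Set (Space d)}
    (hc : IsCompact (crossSection M t)) (hS : IsSimpleCycle M t S) :
    μHE[d - 1] (lift d t ⁻¹' S) < ⊤ ∧ μHE[d - 1] (lift d t ⁻¹' S) ≠ 0 ∧
      ∀ w : (ℝ ∙ axis d)ᗮ, ‖w‖ ≤ 1 →
        ∫ y in lift d t ⁻¹' S, ⟪sectionNormal γ t y, w⟫ ∂μHE[d - 1] = 0 := by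
  obtain ⟨hSt, Ω, hΩ, hfr, hfrc⟩ := hS.bounds
  set j := liftHomeomorph d t
  have hpre : lift d t ⁻¹' S = frontier (j ⁻¹' Ω) := by
    rw [← j.preimage_frontier, hfr]; rfl
  have hcl : frontier (closure (j ⁻¹' Ω)) = frontier (j ⁻¹' Ω) := by
    rw [← j.preimage_closure, ← j.preimage_frontier, ← j.preimage_frontier, hfr, hfrc]
  have himg : lift d t ⁻¹' S = perpProj (axis d) '' S := by
    ext y
    constructor
    · intro hy
      exact ⟨_, hy, j.left_inv y⟩
    · rintro ⟨x, hx, rfl⟩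
      rw [mem_preimage, lift_perpProj (hSt hx)]
      exact hx
  have hcomp : IsCompact (lift d t ⁻¹' S) := by
    rw [himg]; exact (hS.cycle.isCompact hc).image (perpProj (axis d)).continuous
  have hconn : IsConnected (lift d t ⁻¹' S) := by
    rw [himg]; exact hS.connected.image _ (perpProj (axis d)).continuous.continuousOn
  have hk : finrank ℝ (ℝ ∙ axis d)ᗮ = d - 1 + 1 := by
    have : Fact (finrank ℝ (Space d) = d + 1) := ⟨by simp⟩
    rw [Submodule.finrank_orthogonal_span_singleton (n := d)]
    · omega
    · intro h
      have := norm_axis d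
      rw [h, norm_zero] at this
      exact zero_ne_one this
  have hN : ∀ y ∈ lift d t ⁻¹' S, IsNormal (lift d t ⁻¹' S) (sectionNormal γ t y) y :=
    fun y hy => isNormal_cycle hγ hM hS.cycle hy
  have hN1 : ∀ y ∈ lift d t ⁻¹' S, ‖sectionNormal γ t y‖ = 1 := fun y hy =>
    norm_sectionNormal hγ hM hS.cycle.regular (hS.cycle.subset hy)
  have hNc : ContinuousOn (sectionNormal γ t) (lift d t ⁻¹' S) :=
    (continuousOn_sectionNormal hγ hM hS.cycle.regular).mono
      (preimage_mono hS.cycle.subset)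
  rw [hpre] at hcomp hconn hN hN1 hNc ⊢
  exact integral_inner_normal_eq_zero hk (by omega) (hΩ.preimage j.continuous) hcl hcomp hconn
    hNc hN1 hN

end Hypersurface

/-! ### Trigonometry: from integral bounds to angles -/

section Angle

/-- By the addition formulas this says `cos (θ + r) ≤ cos m ≤ cos (θ - r)`, where `θ - r ≤ m ≤ θ +
r`. As `θ ± r` may leave `[0, π]`, the product formula for a difference of cosines replaces
monotonicity. -/
theorem abs_cos_sub_cos_mul_cos_le {θ₁ θ₂ θ : ℝ} (h0 : 0 ≤ θ₁) (hπ : θ₂ ≤ Real.pi)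
    (h₁ : θ₁ ≤ θ) (h₂ : θ ≤ θ₂) :
    |Real.cos ((θ₁ + θ₂) / 2) - Real.cos ((θ₂ - θ₁) / 2) * Real.cos θ| ≤
      Real.sin ((θ₂ - θ₁) / 2) * Real.sin θ := by
  set m := (θ₁ + θ₂) / 2 with hm
  set r := (θ₂ - θ₁) / 2 with hr
  have hadd := Real.cos_add θ r
  have hsub := Real.cos_sub θ r
  have key : ∀ a b : ℝ, 0 ≤ a + b → a + b ≤ 2 * Real.pi → 0 ≤ a - b → a - b ≤ 2 * Real.pi →
      Real.cos a ≤ Real.cos b := by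
    intro a b h1 h2 h3 h4
    have h5 := Real.cos_sub_cos a b
    have h6 : 0 ≤ Real.sin ((a + b) / 2) := Real.sin_nonneg_of_nonneg_of_le_pi (by linarith)
      (by linarith)
    have h7 : 0 ≤ Real.sin ((a - b) / 2) := Real.sin_nonneg_of_nonneg_of_le_pi (by linarith)
      (by linarith)
    nlinarith [mul_nonneg h6 h7]
  have h3 : Real.cos (θ + r) ≤ Real.cos m := by
    apply key <;> rw [hm, hr] <;> linarith
  have h4 : Real.cos m ≤ Real.cos (θ - r) := by
    apply key <;> rw [hm, hr] <;> linarith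
  rw [abs_le]
  constructor <;> nlinarith

/-- A vector whose component orthogonal to the unit vector `e` is bounded by `tan r` times its
component along `e` makes an angle at most `r` with `e`. -/
theorem angle_le_of_forall_inner_le {E : Type*} [NormedAddCommGroup E] [InnerProductSpace ℝ E]
    {e J : E} (he : ‖e‖ = 1) {r : ℝ} (hr0 : 0 ≤ r) (hr : r ≤ Real.pi / 2) (hJ : 0 < ⟪e, J⟫)
    (h : ∀ w : (ℝ ∙ e)ᗮ, ‖w‖ ≤ 1 → Real.cos r * ⟪(w : E), J⟫ ≤ Real.sin r * ⟪e, J⟫) :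
    InnerProductGeometry.angle J e ≤ r := by
  have hc : 0 ≤ Real.cos r := Real.cos_nonneg_of_neg_pi_div_two_le_of_le (by linarith) hr
  have hs : 0 ≤ Real.sin r := Real.sin_nonneg_of_nonneg_of_le_pi hr0 (by linarith [Real.pi_pos])
  have hJ0 : 0 < ‖J‖ := norm_pos_iff.2 fun h0 => by simp [h0] at hJ
  have h1 : Real.cos r * ‖perpProj e J‖ ≤ Real.sin r * ⟪e, J⟫ := by
    by_cases h0 : ‖perpProj e J‖ = 0
    · rw [h0, mul_zero]; positivity
    · have h2 := h (‖perpProj e J‖⁻¹ • perpProj e J)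
        (by rw [norm_smul, norm_inv, norm_norm, inv_mul_cancel₀ h0])
      rwa [real_inner_comm, ← inner_perpProj_left he, real_inner_smul_right,
        real_inner_self_eq_norm_sq, pow_two, inv_mul_cancel_left₀ h0] at h2
  have h2 := norm_sq_perpProj he J
  -- Pythagoras multiplied by `cos r ^ 2`, which avoids the tangent and so includes `r = π / 2`.
  have h3 : Real.cos r * ‖J‖ ≤ ⟪e, J⟫ := by
    refine le_of_sq_le_sq ?_ hJ.le
    have h4 := mul_self_le_mul_self (by positivity) h1
    have h5 := Real.sin_sq_add_cos_sq r
    have h6 : (Real.cos r * ‖J‖) ^ 2 = Real.cos r ^ 2 * ⟪e, J⟫ ^ 2 +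
        (Real.cos r * ‖perpProj e J‖) * (Real.cos r * ‖perpProj e J‖) := by
      have : ‖J‖ ^ 2 = ‖perpProj e J‖ ^ 2 + ⟪e, J⟫ ^ 2 := by linarith
      rw [mul_pow, this]; ring
    rw [h6]
    calc _ ≤ Real.cos r ^ 2 * ⟪e, J⟫ ^ 2 + Real.sin r * ⟪e, J⟫ * (Real.sin r * ⟪e, J⟫) := by
          gcongr
      _ = (Real.sin r ^ 2 + Real.cos r ^ 2) * ⟪e, J⟫ ^ 2 := by ring
      _ = _ := by rw [h5, one_mul]
  rw [InnerProductGeometry.angle, he, mul_one, real_inner_comm,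
    ← Real.arccos_cos hr0 (by linarith [Real.pi_pos])]
  exact Real.arccos_le_arccos ((le_div_iff₀ hJ0).2 h3)

end Angle

/-! ### The flow vector and the final estimate -/

section Flow

variable {d : ℕ} {M S : Set (Space d)}

theorem flowVector_eq {t : ℝ} (hSt : S ⊆ hyperplane d t) :
    flowVector M S = ∫ y in lift d t ⁻¹' S, conormal M (lift d t y) ∂μHE[d - 1] := by
  have hiso := isometry_lift d t
  have hrange : S ⊆ range (lift d t) := fun x hx => ⟨_, lift_perpProj (hSt hx)⟩
  have hemb : MeasurableEmbedding (lift d t) := hiso.isClosedEmbedding.measurableEmbedding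
  rw [← hemb.setIntegral_map, hiso.map_euclideanHausdorffMeasure,
    Measure.restrict_restrict_of_subset hrange]
  rfl

theorem le_sphericalDiam {A : Set (Space d)} {u v : Space d} (hu : u ∈ A) (hv : v ∈ A) :
    InnerProductGeometry.angle u v ≤ sphericalDiam A := by
  refine le_csSup ⟨Real.pi, ?_⟩ ⟨u, hu, v, hv, rfl⟩
  rintro θ ⟨u, -, v, -, rfl⟩
  exact InnerProductGeometry.angle_le_pi u v

theorem two_mul_angle_flowVector_le (hd : 2 ≤ d) {γ : Space d → Space d} (hγ : IsGaussMap M γ)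
    (hM : IsEmbeddedHypersurface M) {t : ℝ} (hc : IsCompact (crossSection M t))
    (hS : IsSimpleCycle M t S) :
    2 * InnerProductGeometry.angle (flowVector M S) (axis d) ≤ sphericalDiam (γ '' S) := by
  obtain ⟨hfin, hpos, hN⟩ := integral_inner_sectionNormal_eq_zero hd hγ hM hc hS
  have hSM := hS.cycle.subset
  have hreg := hS.cycle.regular
  have hSc := hS.cycle.isCompact hc
  have hγS : ContinuousOn γ S := hγ.continuousOn.mono fun p hp => (hSM hp).1
  set θ : Space d → ℝ := fun p => InnerProductGeometry.angle (γ p) (axis d) with hθ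
  have hcosθ : ∀ p ∈ S, Real.cos (θ p) = ⟪axis d, γ p⟫ := by
    intro p hp
    rw [hθ, InnerProductGeometry.cos_angle, norm_axis, hγ.norm_eq_one p (hSM hp).1, mul_one,
      div_one, real_inner_comm]
  have hsinθ : ∀ p ∈ S, Real.sin (θ p) = ‖perpProj (axis d) (γ p)‖ := by
    intro p hp
    rw [norm_perpProj_axis hγ (hSM hp).1, ← hcosθ p hp, Real.sin_eq_sqrt_one_sub_cos_sq
      (InnerProductGeometry.angle_nonneg _ _) (InnerProductGeometry.angle_le_pi _ _)]
  have hppos : ∀ p ∈ S, 0 < ‖perpProj (axis d) (γ p)‖ := fun p hp =>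
    norm_perpProj_axis_pos hγ hM hreg (hSM hp)
  have hγ0 : ∀ p ∈ S, γ p ≠ 0 := fun p hp h0 => by
    have := hγ.norm_eq_one p (hSM hp).1
    rw [h0, norm_zero] at this
    exact zero_ne_one this
  have haxis0 : axis d ≠ 0 := fun h0 => by
    have := norm_axis d
    rw [h0, norm_zero] at this
    exact zero_ne_one this
  have hθc : ContinuousOn θ S := by
    have h1 : ContinuousOn (fun p => Real.arccos (⟪γ p, axis d⟫ / (‖γ p‖ * ‖axis d‖))) S := by
      refine Real.continuous_arccos.comp_continuousOn ?_
      refine (ContinuousOn.inner hγS continuousOn_const).div (hγS.norm.mul continuousOn_const) ?_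
      intro p hp
      exact mul_ne_zero (norm_ne_zero_iff.2 (hγ0 p hp)) (norm_ne_zero_iff.2 haxis0)
    exact h1
  obtain ⟨q, hq, hqmin⟩ := hSc.exists_isMinOn hS.connected.nonempty hθc
  obtain ⟨p, hp, hpmax⟩ := hSc.exists_isMaxOn hS.connected.nonempty hθc
  have hqp : θ q ≤ θ p := hqmin hp
  set r := (θ p - θ q) / 2 with hr
  have hq0 : 0 ≤ θ q := InnerProductGeometry.angle_nonneg _ _
  have hpπ : θ p ≤ Real.pi := InnerProductGeometry.angle_le_pi _ _
  -- `2 * r = θ p - θ q` is at most the angle between `γ p` and `γ q`.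
  suffices hang : InnerProductGeometry.angle (flowVector M S) (axis d) ≤ r by
    have h1 := InnerProductGeometry.angle_le_angle_add_angle (γ p) (γ q) (axis d)
    have h2 := le_sphericalDiam (mem_image_of_mem γ hp) (mem_image_of_mem γ hq)
    have h3 : θ p ≤ InnerProductGeometry.angle (γ p) (γ q) + θ q := h1
    linarith
  set T := lift d t ⁻¹' S with hT
  have hlc : ContinuousOn (fun y => γ (lift d t y)) T :=
    hγS.comp (isometry_lift d t).continuous.continuousOn fun y hy => hy
  have hTm : MeasurableSet T :=
    (hSc.isClosed.preimage (isometry_lift d t).continuous).measurableSet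
  have hfm : IsFiniteMeasure (μHE[d - 1].restrict T) := isFiniteMeasure_restrict.2 hfin.ne
  have hνeq : ∀ y ∈ T, conormal M (lift d t y) = ‖perpProj (axis d) (γ (lift d t y))‖⁻¹ •
      (axis d - ⟪axis d, γ (lift d t y)⟫ • γ (lift d t y)) :=
    fun y hy => conormal_eq hγ hM (hSM hy).1
  have hpc : ContinuousOn (fun y => perpProj (axis d) (γ (lift d t y))) T :=
    (perpProj (axis d)).continuous.comp_continuousOn hlc
  have hνc : ContinuousOn (fun y => conormal M (lift d t y)) T := by
    refine ContinuousOn.congr ?_ hνeq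
    have h1 : ContinuousOn (fun y => ⟪axis d, γ (lift d t y)⟫) T :=
      ContinuousOn.inner continuousOn_const hlc
    exact (hpc.norm.inv₀ fun y hy => (hppos _ hy).ne').smul
      (continuousOn_const.sub (h1.smul hlc))
  have hνi : IntegrableOn (fun y => conormal M (lift d t y)) T μHE[d - 1] := by
    refine Integrable.of_bound (hνc.aestronglyMeasurable hTm) 1 (ae_of_all _ fun y => ?_)
    rw [conormal, norm_smul, norm_inv, norm_norm]
    exact inv_mul_le_one
  have hinner : ∀ w : Space d, ⟪w, flowVector M S⟫ =
      ∫ y in T, ⟪w, conormal M (lift d t y)⟫ ∂μHE[d - 1] := fun w => by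
    rw [flowVector_eq hS.bounds.1, integral_inner hνi]
  have hsi : IntegrableOn (fun y => Real.sin (θ (lift d t y))) T μHE[d - 1] := by
    refine Integrable.of_bound (ContinuousOn.aestronglyMeasurable ?_ hTm) 1
      (ae_of_all _ fun y => Real.abs_sin_le_one _)
    exact Real.continuous_sin.comp_continuousOn
      (hθc.comp (isometry_lift d t).continuous.continuousOn fun y hy => hy)
  have hJe : ⟪axis d, flowVector M S⟫ = ∫ y in T, Real.sin (θ (lift d t y)) ∂μHE[d - 1] := by
    rw [hinner]
    refine setIntegral_congr_fun hTm fun y hy => ?_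
    have h1 := norm_sq_perpProj (norm_axis d) (γ (lift d t y))
    rw [hγ.norm_eq_one _ (hSM hy).1] at h1
    have h2 := (hppos _ hy).ne'
    change ⟪axis d, conormal M (lift d t y)⟫ = Real.sin (θ (lift d t y))
    rw [hνeq y hy, hsinθ _ hy, inner_smul_right, inner_sub_right, inner_smul_right,
      real_inner_self_eq_norm_sq, norm_axis, ← pow_two, inv_mul_eq_div, div_eq_iff h2]
    linarith
  have hJpos : 0 < ⟪axis d, flowVector M S⟫ := by
    rw [hJe, setIntegral_pos_iff_support_of_nonneg_ae _ hsi]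
    · have h1 : T ⊆ Function.support (fun y => Real.sin (θ (lift d t y))) := fun y hy => by
        rw [Function.mem_support, hsinθ _ hy]
        exact (hppos _ hy).ne'
      rw [inter_eq_right.2 h1]
      exact pos_iff_ne_zero.2 hpos
    · exact ae_of_all _ fun y => InnerProductGeometry.sin_angle_nonneg _ _
  have hr0 : 0 ≤ r := by rw [hr]; linarith
  refine angle_le_of_forall_inner_le (norm_axis d) hr0 (by rw [hr]; linarith) hJpos fun w hw => ?_
  -- The horizontal part of the conormal is `-cos θ` times the section normal.
  have hJw : ∀ y ∈ T, ⟪(w : Space d), conormal M (lift d t y)⟫ =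
      -(Real.cos (θ (lift d t y)) * ⟪sectionNormal γ t y, w⟫) := by
    intro y hy
    have h1 : ⟪(w : Space d), axis d⟫ = 0 :=
      Submodule.mem_orthogonal_singleton_iff_inner_left.1 w.2
    rw [hνeq y hy, hcosθ _ hy, sectionNormal, inner_smul_right, inner_sub_right, h1,
      inner_smul_right, real_inner_smul_left, inner_perpProj_left (norm_axis d),
      real_inner_comm (w : Space d)]
    ring
  set m := (θ q + θ p) / 2 with hm
  have hNc : ContinuousOn (sectionNormal γ t) T :=
    (continuousOn_sectionNormal hγ hM hreg).mono (preimage_mono hSM)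
  have hNw : ∀ y ∈ T, |⟪sectionNormal γ t y, w⟫| ≤ 1 := by
    intro y hy
    have h1 := abs_real_inner_le_norm (sectionNormal γ t y) w
    rw [norm_sectionNormal hγ hM hreg (hSM hy), one_mul] at h1
    exact h1.trans hw
  have hNi : IntegrableOn (fun y => ⟪sectionNormal γ t y, w⟫) T μHE[d - 1] := by
    refine Integrable.of_bound ((ContinuousOn.inner hNc continuousOn_const).aestronglyMeasurable
      hTm) 1 ((ae_restrict_iff' hTm).2 (ae_of_all _ hNw))
  have hwi : IntegrableOn (fun y => ⟪(w : Space d), conormal M (lift d t y)⟫) T μHE[d - 1] :=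
    hνi.const_inner _
  -- The added `cos m` term integrates to zero; it recentres the coefficient of `⟪N, w⟫` to `cos m -
  -- cos r cos θ`, which is bounded pointwise by `sin r sin θ`.
  calc Real.cos r * ⟪(w : Space d), flowVector M S⟫
      = ∫ y in T, (Real.cos r * ⟪(w : Space d), conormal M (lift d t y)⟫ +
          Real.cos m * ⟪sectionNormal γ t y, w⟫) ∂μHE[d - 1] := by
        rw [integral_add (hwi.const_mul _) (hNi.const_mul _), integral_const_mul,
          integral_const_mul, hN w hw, mul_zero, add_zero, hinner]
    _ ≤ ∫ y in T, Real.sin r * Real.sin (θ (lift d t y)) ∂μHE[d - 1] := by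
        refine setIntegral_mono_on ((hwi.const_mul _).add (hNi.const_mul _)) (hsi.const_mul _) hTm
          fun y hy => ?_
        rw [hJw y hy]
        have h1 := abs_cos_sub_cos_mul_cos_le hq0 hpπ (hqmin hy) (hpmax hy)
        calc _ = (Real.cos m - Real.cos r * Real.cos (θ (lift d t y))) *
                ⟪sectionNormal γ t y, w⟫ := by ring
          _ ≤ |Real.cos m - Real.cos r * Real.cos (θ (lift d t y))| *
                |⟪sectionNormal γ t y, w⟫| := by rw [← abs_mul]; exact le_abs_self _
          _ ≤ |Real.cos m - Real.cos r * Real.cos (θ (lift d t y))| * 1 := by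
                gcongr; exact hNw y hy
          _ ≤ _ := by rw [mul_one]; exact h1
    _ = Real.sin r * ⟪axis d, flowVector M S⟫ := by rw [integral_const_mul, hJe]

end Flow

end MinimalTube

theorem theorem1 (d : ℕ) (hd : 2 ≤ d) (M : Set (MinimalTube.Space d)) (I : Set ℝ)
    (hM : MinimalTube.IsEmbeddedHypersurface M) (hmin : MinimalTube.IsMinimal M)
    (htube : MinimalTube.IsTube M I)
    (γ : MinimalTube.Space d → MinimalTube.Space d) (hγ : MinimalTube.IsGaussMap M γ)
    (t : ℝ) (ht : t ∈ I) (S : Set (MinimalTube.Space d))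
    (hS : MinimalTube.IsSimpleCycle M t S) :
    2 * InnerProductGeometry.angle (MinimalTube.flowVector M S) (MinimalTube.axis d)
      ≤ MinimalTube.sphericalDiam (γ '' S) :=
  MinimalTube.two_mul_angle_flowVector_le hd hγ hM (htube.section_compact t ht) hS
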